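/- Write $\Sigma_2=\{0,1\}$, and for a binary word $x=e_t\cdots e_2$ (most significant digit first) let $[x]=\sum_{i=2}^{t} e_iF_i$, where $F_i$ are the Fibonacci numbers; $x$ is a valid Fibonacci representation if it does not contain $11$. For words $x,z$ of the same length, $x\times z$ is the word over $\Sigma_2\times\Sigma_2$ with components $x$ and $z$. For $n\ge 1$ and $0\le c<n$, let $M_{n,c}$ be the automaton constructed as follows by the decision procedure for Büchi arithmetic. An automaton for a formula $\exists y\ A\wedge B$ is obtained from automata for $A$ and $B$ by the product construction, the projection that removes the track $y$ from the transitions, the subset construction, and minimization (removal of dead states, then Hopcroft's partition refinement). Here automata are deterministic with partial transition functions, except that the projection may give a nondeterministic one. Only accessible states are constructed in the product and the subset construction. Starting from fixed automata for $[x]=0$, $[x]=1$, $[x]=[y]$ and $[x]+[y]=[z]$, one constructs in this way * $M_{=c}$ for $[x]=c$, recursively: $\exists y\ [y]=c/2\wedge [y]+[y]=[x]$ if $c>0$ is even, $\exists y\ [y]=c-1\wedge [y]+1=[x]$ if $c$ is odd; * $M_c$ for $[x]+c=[z]$: $\exists y\ [x]+[y]=[z]\wedge [y]=c$; * $M_n$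 for $n[x]=[z]$, recursively: $\exists y\ (n/2)[x]=[y]\wedge [y]+[y]=[z]$ if $n$ is even, $\exists y\ (n-1)[x]=[y]\wedge [x]+[y]=[z]$ if $n>1$ is odd; * finally $M_{n,c}$: $\exists y\ M_n(x,y)\wedge M_c(y,z)$. The time of the construction, including that of all the recursively constructed automata, is measured by the number of transitions traversed (plus the number of states created): in the product construction and the projection all transitions of the product; in the subset construction, for every subset reached, all transitions leaving its elements; in the minimization all transitions when dead states are removed, and then, for each pair (block $B$, letter $a$) used as a splitter, one plus the number of transitions with letter $a$ into $B$. Then $M_{n,c}$ is the minimal automaton (without dead state) recognizing $n[x]+c=[z]$ on input $x\times z$, that is, accepting exactly the words $x\times z$ such that $x$ and $z$ are valid Fibonacci representations and $n[x]+c=[z]$. It has a self-loop on its initial state on the letter $[0,0]$. It is computed in $O(n^6\log^2 n)$ time: there is an absolute constant $C$ such that for all $n\ge 1$ and $0\le c<n$, and for every order in which the minimizations process their splitters, the construction terminates with time at most $C\,n^6\log^2 n$, where $\log 1$ is read as $1$. -/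

import Mathlib

/-! Partial deterministic finite automata. -/

/-- A deterministic finite automaton over `α` with a partial transition function. -/
structure PDFA (α : Type) where
  State : Type
  finite : Finite State
  start : State
  step : State → α → Option State
  accept : Set State

attribute [instance] PDFA.finite

namespace PDFA

variable {α β γ δ : Type}

/-- The state reached from `q` on the word `w`, if it is defined. -/
def runFrom (M : PDFA α) (q : M.State) : List α → Option M.State
  | [] => some q
  | a :: w => (M.step q a).bind fun q' => M.runFrom q' w

/-- The language recognized by `M`. -/
def language (M : PDFA α) : Language α :=
  {w | ∃ q ∈ M.accept, M.runFrom M.start w = some q}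

/-- `q` is reachable from the initial state. -/
def Accessible (M : PDFA α) (q : M.State) : Prop :=
  ∃ w, M.runFrom M.start w = some q

/-- Some accepting state is reachable from `q` (that is, `q` is not dead). -/
def Coaccessible (M : PDFA α) (q : M.State) : Prop :=
  ∃ w, ∃ p ∈ M.accept, M.runFrom q w = some p

/-- `M` is a minimal automaton for its language, where the dead state is not represented:
all states are accessible, no state is dead, and distinct states accept different sets of words. -/
def IsMinimal (M : PDFA α) : Prop :=
  (∀ q, M.Accessible q ∧ M.Coaccessible q) ∧
  ∀ q q' : M.State,
    (∀ w, (∃ p ∈ M.accept, M.runFrom q w = some p) ↔ ∃ p ∈ M.accept, M.runFrom q' w = some p) →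
    q = q'

/-- The number of transitions of `M`. -/
noncomputable def numTransitions (M : PDFA α) : ℕ :=
  Set.ncard {t : M.State × α | (M.step t.1 t.2).isSome}

/-- The number of states plus the number of transitions of `M`. -/
noncomputable def size (M : PDFA α) : ℕ :=
  Nat.card M.State + M.numTransitions

open Classical in
/-- The automaton obtained from `M` by keeping only the states in `S`. -/
noncomputable def restrict (M : PDFA α) (S : Set M.State) (hS : M.start ∈ S) : PDFA α where
  State := S
  finite := inferInstance
  start := ⟨M.start, hS⟩
  step q a := (M.step q a).bind fun q' => if h : q' ∈ S then some ⟨q', h⟩ else none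
  accept := {q | q.1 ∈ M.accept}

/-- The accessible part of `M`. -/
noncomputable def accessiblePart (M : PDFA α) : PDFA α :=
  M.restrict {q | M.Accessible q} ⟨[], rfl⟩

/-- `M` without its dead states (the initial state is always kept). -/
noncomputable def trim (M : PDFA α) : PDFA α :=
  M.restrict {q | q = M.start ∨ M.Coaccessible q} (Or.inl rfl)

/-! ### Product, projection, determinization -/

/-- The accessible part of the product of `A` and `B`, over the alphabet `γ`, where on the
letter `c` the automaton `A` reads `f c` and `B` reads `g c`. -/
noncomputable def product (A : PDFA α) (f : γ → α) (B : PDFA β) (g : γ → β) : PDFA γ :=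
  accessiblePart
    { State := A.State × B.State
      finite := inferInstance
      start := (A.start, B.start)
      step := fun q c =>
        (A.step q.1 (f c)).bind fun q₁ => (B.step q.2 (g c)).map fun q₂ => (q₁, q₂)
      accept := {q | q.1 ∈ A.accept ∧ q.2 ∈ B.accept} }

/-- The nondeterministic automaton obtained by replacing each letter `c` on the transitions
of `P` with `h c`. If `h` forgets a track, this is the projection that removes that track. -/
def project (P : PDFA γ) (h : γ → δ) : NFA δ P.State where
  step q d := {p | ∃ c, h c = d ∧ P.step q c = some p}
  start := {P.start}
  accept := P.accept

open Classical in
/-- The subset construction on all subsets of states; a transition that would lead to the empty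
set is left undefined. -/
noncomputable def powerset {σ : Type} [Finite σ] (N : NFA δ σ) : PDFA δ where
  State := Set σ
  finite := inferInstance
  start := N.start
  step S d := if (N.stepSet S d).Nonempty then some (N.stepSet S d) else none
  accept := {S | ∃ q ∈ S, q ∈ N.accept}

/-- The subset construction, keeping only the subsets that are reached. -/
noncomputable def determinize {σ : Type} [Finite σ] (N : NFA δ σ) : PDFA δ :=
  (powerset N).accessiblePart

/-- The set of states of `N` that a state of the subset automaton stands for. -/
def members {σ : Type} [Finite σ] {N : NFA δ σ} (S : (determinize N).State) : Set σ :=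
  S.1

/-- The number of times that a transition of `N` is traversed in the subset construction:
for every subset that is reached, all transitions that leave one of its elements are traversed. -/
noncomputable def subsetTime {σ : Type} [Finite σ] (N : NFA δ σ) : ℕ :=
  Set.ncard {t : (determinize N).State × σ × δ × σ |
    t.2.1 ∈ members t.1 ∧ t.2.2.2 ∈ N.step t.2.1 t.2.2.1}

/-! ### Minimization: Hopcroft's partition refinement -/

/-- The states from which the letter `a` leads into `B`. -/
def pre (M : PDFA α) (B : Set M.State) (a : α) : Set M.State :=
  {q | ∃ p ∈ B, M.step q a = some p}

/-- A configuration: the current partition of the states, and the worklist of pairs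
(block, letter) that still have to be used as splitters. -/
abbrev Config (M : PDFA α) : Type := Setoid M.State × Set (Set M.State × α)

/-- Split every block of `r` into its part inside `X` and its part outside `X`. -/
def splitBy {Q : Type} (r : Setoid Q) (X : Set Q) : Setoid Q :=
  r ⊓ Setoid.ker fun q => q ∈ X

open Classical in
/-- The smaller one of the two parts into which `X` splits `Y`. -/
noncomputable def smallerPart {Q : Type} (Y X : Set Q) : Set Q :=
  if (Y ∩ X).ncard ≤ (Y \ X).ncard then Y ∩ X else Y \ X

/-- The worklist after the blocks of `r` have been split by `X`: if `(Y, b)` was in the worklist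
then all (nonempty) parts of `Y` are in the new one with `b`; otherwise, if `Y` is really
split, the smaller part is added for every letter `b`. -/
def splitWorklist {Q : Type} (r : Setoid Q) (W : Set (Set Q × α)) (X : Set Q) :
    Set (Set Q × α) :=
  {z | ∃ Y ∈ r.classes, (z.1 = Y ∩ X ∨ z.1 = Y \ X) ∧ z.1.Nonempty ∧
    ((Y, z.2) ∈ W ∨ ((Y ∩ X).Nonempty ∧ (Y \ X).Nonempty ∧ z.1 = smallerPart Y X))}

/-- Start with the partition into accepting and non-accepting states, with all
splitters in the worklist. -/
def hopcroftInit (M : PDFA α) : M.Config :=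
  (Setoid.ker fun q => q ∈ M.accept,
    {z | z.1 ∈ (Setoid.ker fun q => q ∈ M.accept).classes})

/-- `M.HopcroftRun s r t`: in `t` steps the main loop, started in the configuration `s`, empties
the worklist and ends with the partition `r`. A round of the loop takes an arbitrary pair
`(B, a)` out of the worklist and splits by `pre B a`; it traverses, backwards, all transitions
with letter `a` into `B`, and its time is one plus their number. -/
inductive HopcroftRun (M : PDFA α) : M.Config → Setoid M.State → ℕ → Prop
  | done (r : Setoid M.State) : HopcroftRun M (r, ∅) r 0
  | round (r r' : Setoid M.State) (W : Set (Set M.State × α)) (B : Set M.State) (a : α) (t : ℕ)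
      (hB : (B, a) ∈ W)
      (h : HopcroftRun M
        (splitBy r (M.pre B a), splitWorklist r (W \ {(B, a)}) (M.pre B a)) r' t) :
      HopcroftRun M (r, W) r' (1 + (M.pre B a).ncard + t)

/-- The automaton whose states are the blocks of `r`; the transitions of a block are read off
from a representative of it. -/
noncomputable def quotient (M : PDFA α) (r : Setoid M.State) : PDFA α where
  State := Quotient r
  finite := inferInstance
  start := Quotient.mk r M.start
  step c a := (M.step c.out a).map (Quotient.mk r)
  accept := Quotient.mk r '' M.accept

/-- `M.Minimizes M' t`: minimization of `M` may return `M'` after time `t`. It first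
removes the dead states, which traverses every transition once, and then runs
Hopcroft's partition refinement. -/
def Minimizes (M M' : PDFA α) (t : ℕ) : Prop :=
  ∃ r t', M.trim.HopcroftRun M.trim.hopcroftInit r t' ∧
    M' = M.trim.quotient r ∧ t = M.size + t'

/-- `Combine A f B g h M t`: in time `t`, `M` is constructed from the automata `A` and `B` as
the automaton for `∃ …, A(…) ∧ B(…)`: product construction, projection (relabelling every
transition), subset construction, and minimization. -/
def Combine (A : PDFA α) (f : γ → α) (B : PDFA β) (g : γ → β) (h : γ → δ) (M : PDFA δ)
    (t : ℕ) : Prop :=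
  ∃ t', (determinize (project (product A f B g) h)).Minimizes M t' ∧
    t = (product A f B g).size + (product A f B g).numTransitions +
      subsetTime (project (product A f B g) h) + t'

end PDFA

/-! Fibonacci representation, most significant digit first. -/
namespace Fibonacci

open PDFA

/-- The integer `[x]` represented by the word `x = e_t ⋯ e_2`, i.e. the sum of the `e_i F_i`. -/
def value : List (Fin 2) → ℕ
  | [] => 0
  | a :: x => (a : ℕ) * Nat.fib (x.length + 2) + value x

/-- `x` is a valid representation: it has no two consecutive digits `1`. -/
def Valid (x : List (Fin 2)) : Prop :=
  x.IsChain fun a b => ¬ (a = 1 ∧ b = 1)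

/-- The words `x × z`, with `x` and `z` valid, such that `n[x] + c = [z]`. -/
def linearLanguage (n c : ℕ) : Language (Fin 2 × Fin 2) :=
  {w | Valid (w.map Prod.fst) ∧ Valid (w.map Prod.snd) ∧
    n * value (w.map Prod.fst) + c = value (w.map Prod.snd)}

/-! ### The basic automata, of constant size -/

/-- The automaton for `[x] = 0`. -/
def zeroAut : PDFA (Fin 2) where
  State := Unit
  finite := inferInstance
  start := ()
  step _ a := if a = 0 then some () else none
  accept := Set.univ

/-- The automaton for `[x] = 1`; its state is the last letter read. -/
def oneAut : PDFA (Fin 2) where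
  State := Fin 2
  finite := inferInstance
  start := 0
  step s a := if s = 0 then some a else none
  accept := {1}

/-- The automaton for `[x] = [y]`; its state is the last letter read on both tracks. -/
def eqAut : PDFA (Fin 2 × Fin 2) where
  State := Fin 2
  finite := inferInstance
  start := 0
  step s l := if l.1 = l.2 ∧ ¬ (s = 1 ∧ l.1 = 1) then some l.1 else none
  accept := Set.univ

/-- The difference `a + b - e` of three digits. -/
def digitDiff (l : Fin 2 × Fin 2 × Fin 2) : ℤ :=
  ((l.1 : ℕ) : ℤ) + ((l.2.1 : ℕ) : ℤ) - ((l.2.2 : ℕ) : ℤ)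

/-- The automaton for `[x] + [y] = [z]`. On the input `xa × yb × ze` it reaches the state
`((a, b, e), [xa] + [yb] - [ze], [x] + [y] - [z])`. Differences outside `[-4, 4]` never
return to `0`. -/
def addAut : PDFA (Fin 2 × Fin 2 × Fin 2) where
  State := (Fin 2 × Fin 2 × Fin 2) × Set.Icc (-4 : ℤ) 4 × Set.Icc (-4 : ℤ) 4
  finite := inferInstance
  start := ((0, 0, 0), ⟨0, by decide⟩, ⟨0, by decide⟩)
  step q l :=
    if h : (¬ (q.1.1 = 1 ∧ l.1 = 1) ∧ ¬ (q.1.2.1 = 1 ∧ l.2.1 = 1) ∧ ¬ (q.1.2.2 = 1 ∧ l.2.2 = 1)) ∧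
        (-4 ≤ q.2.1.1 + q.2.2.1 + digitDiff q.1 + digitDiff l ∧
          q.2.1.1 + q.2.2.1 + digitDiff q.1 + digitDiff l ≤ 4)
    then some (l, ⟨q.2.1.1 + q.2.2.1 + digitDiff q.1 + digitDiff l, h.2⟩, q.2.1)
    else none
  accept := {q | q.2.1.1 = 0}

/-! ### The recursive constructions, with the time they take -/

/-- Construction of the automaton for `[y] + 1 = [x]` on input `y × x`:
`∃ w, [w] = 1 ∧ [y] + [w] = [x]`, with the tracks `(y, w, x)`. -/
def BuildSucc (M : PDFA (Fin 2 × Fin 2)) (t : ℕ) : Prop :=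
  Combine oneAut (fun l : Fin 2 × Fin 2 × Fin 2 => l.2.1) addAut id (fun l => (l.1, l.2.2)) M t

/-- `BuildConst c M t`: the recursive construction of the automaton `M` for `[x] = c`, in time `t`:
`∃ y, [y] = c/2 ∧ [y] + [y] = [x]` if `c` is even, and
`∃ y, [y] = c - 1 ∧ [y] + 1 = [x]` if `c` is odd, with the tracks `(y, x)`. -/
inductive BuildConst : ℕ → PDFA (Fin 2) → ℕ → Prop
  | zero : BuildConst 0 zeroAut zeroAut.size
  | even (k : ℕ) (A M : PDFA (Fin 2)) (s t : ℕ) (hk : 1 ≤ k) (hA : BuildConst k A s)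
      (hM : Combine A (fun l : Fin 2 × Fin 2 => l.1) addAut (fun l => (l.1, l.1, l.2))
        (fun l => l.2) M t) :
      BuildConst (2 * k) M (s + t)
  | odd (k : ℕ) (A M : PDFA (Fin 2)) (S : PDFA (Fin 2 × Fin 2)) (s u t : ℕ)
      (hA : BuildConst (2 * k) A s) (hS : BuildSucc S u)
      (hM : Combine A (fun l : Fin 2 × Fin 2 => l.1) S id (fun l => l.2) M t) :
      BuildConst (2 * k + 1) M (s + u + t)

/-- `BuildShift c M t`: construction of the automaton `M` for `[x] + c = [z]` on input `x × z`, in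
time `t`: `∃ y, [x] + [y] = [z] ∧ [y] = c`, with the tracks `(x, y, z)`. -/
def BuildShift (c : ℕ) (M : PDFA (Fin 2 × Fin 2)) (t : ℕ) : Prop :=
  ∃ A s u, BuildConst c A s ∧
    Combine addAut id A (fun l : Fin 2 × Fin 2 × Fin 2 => l.2.1) (fun l => (l.1, l.2.2)) M u ∧
    t = s + u

/-- `BuildMul n M t`: the recursive construction of the automaton `M` for `n[x] = [z]` on input
`x × z`, in time `t`: `∃ y, (n/2)[x] = [y] ∧ [y] + [y] = [z]` if `n` is even, and
`∃ y, (n-1)[x] = [y] ∧ [x] + [y] = [z]` if `n > 1` is odd, with the tracks `(x, y, z)`. -/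
inductive BuildMul : ℕ → PDFA (Fin 2 × Fin 2) → ℕ → Prop
  | one : BuildMul 1 eqAut eqAut.size
  | even (k : ℕ) (A M : PDFA (Fin 2 × Fin 2)) (s t : ℕ) (hk : 1 ≤ k) (hA : BuildMul k A s)
      (hM : Combine A (fun l : Fin 2 × Fin 2 × Fin 2 => (l.1, l.2.1)) addAut
        (fun l => (l.2.1, l.2.1, l.2.2)) (fun l => (l.1, l.2.2)) M t) :
      BuildMul (2 * k) M (s + t)
  | odd (k : ℕ) (A M : PDFA (Fin 2 × Fin 2)) (s t : ℕ) (hk : 1 ≤ k) (hA : BuildMul (2 * k) A s)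
      (hM : Combine A (fun l : Fin 2 × Fin 2 × Fin 2 => (l.1, l.2.1)) addAut id
        (fun l => (l.1, l.2.2)) M t) :
      BuildMul (2 * k + 1) M (s + t)

/-- `BuildLinear n c M t`: construction of the automaton `M` for `n[x] + c = [z]` on input
`x × z`, in time `t`: `∃ y, n[x] = [y] ∧ [y] + c = [z]`, with the tracks `(x, y, z)`. The time
includes that of the construction of the two automata that are combined. -/
def BuildLinear (n c : ℕ) (M : PDFA (Fin 2 × Fin 2)) (t : ℕ) : Prop :=
  ∃ A B s u v, BuildMul n A s ∧ BuildShift c B u ∧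
    Combine A (fun l : Fin 2 × Fin 2 × Fin 2 => (l.1, l.2.1)) B (fun l => (l.2.1, l.2.2))
      (fun l => (l.1, l.2.2)) M v ∧
    t = s + u + v

/-- The logarithm as it is used in asymptotic bounds: `log i` is read as `1` for `i ≤ 1`. -/
noncomputable def logO (i : ℕ) : ℝ :=
  if i ≤ 1 then 1 else Real.log i

end Fibonacci

/-! Every automaton of the construction recognizes a linear relation: writing `fibSum 2 k w` for the
sum of the integer digits `k` of the letters weighted by Fibonacci numbers, it accepts the
compatible words where this sum has a prescribed value. The residual language of a word depends only
on its sum, its shifted sum `fibSum 3 k w` (indices raised by one) and its last letter, because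
appending a letter acts linearly on the two sums. If the digits are bounded by `P`, the shifted sum
is within `P` of `φ` times the sum (`abs_shiftError_le`), and a sum exceeding `4 * P` in absolute
value grows too fast ever to return (`lt_abs_fibSum_concat`). In a minimal automaton, where every
run can be completed, all sums are therefore `O(n)`.

Consider one elimination of a track `y`, with sums bounded by `R = O(n)`. The product has `O(R^3)`
states: sum and excess of the shifted sum on the left, sum on the right, and boundedly many choices
for the rest. The main point is that the subset construction reaches only `O(R^5)` subsets. For a
visible word take the run whose eliminated track has the least value `Y`. Every other run has value
`Y + i` with `i ≤ 2 * R`, since the left sum sees `y` with a nonzero coefficient. Its effect on the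
shifted sums and on the last letter is governed by `⌊φ * (Y + i + 1)⌋ - ⌊φ * (Y + 1)⌋`, so it
depends only on `i` and the fractional part of `φ * (Y + 1)`. These sequences of increments exceed
`⌊φ * i⌋` by 0 or 1 and increase with the fractional part, so only `O(R)` of them occur. The last
datum is how many values above `Y` still fit into the word length, capped at `2 * R`. Hence the
factor `O(R^2)` over the `O(R^3)` keys (`ProductRun.transfer`, `card_determinize_le`). A subset has
at most `2 * R + 1` elements, as its elements are told apart by the left sum (`ncard_members_le`),
so the subset construction takes `O(R^6)`.

Hopcroft's refinement takes `O(N log N)` on `N` states, in any order of the splitters. Each pair of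
a state and a letter holds a credit, the binary logarithm of its block size plus one if the block
with that letter is waiting; a newly queued part is at most half of its block, so the lost logarithm
pays for its entry (`potential_round`). One elimination thus costs `O(n^6 log n)`. The recursions
for `c` and `n` perform `O(log n)` eliminations, whence the second logarithm. -/

namespace PDFA

variable {α β γ δ : Type}

/-! ### Runs -/

theorem runFrom_append (M : PDFA α) (q : M.State) (u v : List α) :
    M.runFrom q (u ++ v) = (M.runFrom q u).bind fun p => M.runFrom p v := by
  induction u generalizing q with
  | nil => rfl
  | cons a u ih =>
    simp only [List.cons_append, runFrom]
    cases h : M.step q a with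
    | none => rfl
    | some p => simpa using ih p

theorem runFrom_concat (M : PDFA α) (q : M.State) (u : List α) (a : α) :
    M.runFrom q (u ++ [a]) = (M.runFrom q u).bind fun p => M.step p a := by
  rw [runFrom_append]
  congr 1
  funext p
  simp [runFrom]

/-- Some accepting state is reached from `q` on the word `w`. -/
def AcceptsFrom (M : PDFA α) (q : M.State) (w : List α) : Prop :=
  ∃ p ∈ M.accept, M.runFrom q w = some p

theorem acceptsFrom_of_runFrom {M : PDFA α} {q p : M.State} {u : List α}
    (h : M.runFrom q u = some p) (v : List α) :
    M.AcceptsFrom p v ↔ M.AcceptsFrom q (u ++ v) := by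
  simp [AcceptsFrom, runFrom_append, h]

theorem mem_language {M : PDFA α} {w : List α} :
    w ∈ M.language ↔ M.AcceptsFrom M.start w := Iff.rfl

theorem exists_runFrom_of_acceptsFrom_append {M : PDFA α} {q : M.State} {u v : List α}
    (h : M.AcceptsFrom q (u ++ v)) : ∃ p, M.runFrom q u = some p ∧ M.AcceptsFrom p v := by
  obtain ⟨p, hp, hr⟩ := h
  rw [runFrom_append] at hr
  obtain ⟨p', h1, h2⟩ := Option.bind_eq_some_iff.mp hr
  exact ⟨p', h1, p, hp, h2⟩

theorem numTransitions_le (M : PDFA α) [Fintype α] :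
    M.numTransitions ≤ Nat.card M.State * Fintype.card α := by
  rw [numTransitions, ← Nat.card_eq_fintype_card, ← Nat.card_prod]
  exact Set.ncard_le_card _

theorem size_le (M : PDFA α) [Fintype α] :
    M.size ≤ Nat.card M.State * (1 + Fintype.card α) := by
  have := M.numTransitions_le
  rw [size]
  linarith [mul_add (Nat.card M.State) 1 (Fintype.card α)]

/-! ### Restriction to a set of states -/

theorem runFrom_of_runFrom_restrict {M : PDFA α} {S : Set M.State} {hS : M.start ∈ S} {q p : S}
    {w : List α} (h : (M.restrict S hS).runFrom q w = some p) : M.runFrom q.1 w = some p.1 := by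
  induction w generalizing q with
  | nil => exact congrArg some (congrArg Subtype.val (Option.some.inj h))
  | cons a w ih =>
    obtain ⟨q', h1, h2⟩ := Option.bind_eq_some_iff.mp h
    obtain ⟨q'', h3, h4⟩ := Option.bind_eq_some_iff.mp h1
    split at h4
    · obtain rfl := Option.some.inj h4
      simp only [runFrom, h3, Option.bind_some]
      exact ih h2
    · simp at h4

theorem runFrom_restrict {M : PDFA α} {S : Set M.State} {hS : M.start ∈ S} {q p : S}
    {w : List α} (h : M.runFrom q.1 w = some p.1)
    (hmid : ∀ u v r, w = u ++ v → M.runFrom q.1 u = some r → r ∈ S) :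
    (M.restrict S hS).runFrom q w = some p := by
  induction w generalizing q with
  | nil => exact congrArg some (Subtype.ext (Option.some.inj h))
  | cons a w ih =>
    obtain ⟨q', h1, h2⟩ := Option.bind_eq_some_iff.mp h
    have hq' : q' ∈ S := hmid [a] w q' rfl (by simp [runFrom, h1])
    have hstep : (M.restrict S hS).step q a = some ⟨q', hq'⟩ := by
      simp [restrict, h1, hq']
    simp only [runFrom, hstep]
    refine ih (q := ⟨q', hq'⟩) h2 fun u v r huv hr => hmid (a :: u) v r (by simp [huv]) ?_
    simp [runFrom, h1, hr]

theorem runFrom_accessiblePart_iff {M : PDFA α} {w : List α} {p : M.accessiblePart.State} :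
    M.accessiblePart.runFrom M.accessiblePart.start w = some p ↔
      M.runFrom M.start w = some p.1 :=
  ⟨runFrom_of_runFrom_restrict, fun h =>
    runFrom_restrict (q := ⟨M.start, _⟩) h fun u _ _ _ hr => ⟨u, hr⟩⟩

theorem accessible_accessiblePart (M : PDFA α) (p : M.accessiblePart.State) :
    M.accessiblePart.Accessible p := by
  obtain ⟨w, hw⟩ := p.2
  exact ⟨w, runFrom_accessiblePart_iff.mpr hw⟩

theorem mem_language_accessiblePart {M : PDFA α} {w : List α} :
    w ∈ M.accessiblePart.language ↔ w ∈ M.language := by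
  constructor
  · rintro ⟨p, hp, h⟩
    exact ⟨p.1, hp, runFrom_accessiblePart_iff.mp h⟩
  · rintro ⟨p, hp, h⟩
    exact ⟨⟨p, w, h⟩, hp, runFrom_accessiblePart_iff.mpr h⟩

theorem runFrom_trim {M : PDFA α} {w : List α} {q p : M.trim.State}
    (h : M.runFrom q.1 w = some p.1) (hp : M.Coaccessible p.1) :
    M.trim.runFrom q w = some p := by
  refine runFrom_restrict h fun u v r huv hr => Or.inr ?_
  obtain ⟨x, p', hp', hx⟩ := hp
  rw [huv, runFrom_append, hr, Option.bind_some] at h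
  exact ⟨v ++ x, p', hp', by rw [runFrom_append, h, Option.bind_some, hx]⟩

theorem mem_language_trim {M : PDFA α} {w : List α} :
    w ∈ M.trim.language ↔ w ∈ M.language := by
  constructor
  · rintro ⟨p, hp, h⟩
    exact ⟨p.1, hp, runFrom_of_runFrom_restrict h⟩
  · rintro ⟨p, hp, h⟩
    have hc : M.Coaccessible p := ⟨[], p, hp, rfl⟩
    exact ⟨⟨p, Or.inr hc⟩, hp, runFrom_trim h hc⟩

/-- Trimming keeps the initial state even if it is dead; nonemptiness of the language excludes this
case. For this reason each relation constructed later comes with an explicit solution. -/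
theorem coaccessible_trim {M : PDFA α} (hne : ∃ w, w ∈ M.language) (p : M.trim.State) :
    M.trim.Coaccessible p := by
  have hp : M.Coaccessible p.1 := by
    rcases p.2 with h | h
    · obtain ⟨w, hw⟩ := hne
      rw [h]
      exact ⟨w, hw⟩
    · exact h
  obtain ⟨w, p', hp', hw⟩ := hp
  have hc : M.Coaccessible p' := ⟨[], p', hp', rfl⟩
  exact ⟨w, ⟨p', Or.inr hc⟩, hp', runFrom_trim hw hc⟩

theorem accessible_trim {M : PDFA α} (hacc : ∀ q, M.Accessible q) (p : M.trim.State) :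
    M.trim.Accessible p := by
  rcases p with ⟨p, h | h⟩
  · subst h
    exact ⟨[], rfl⟩
  · obtain ⟨w, hw⟩ := hacc p
    exact ⟨w, runFrom_trim hw h⟩

theorem card_trim_le (M : PDFA α) : Nat.card M.trim.State ≤ Nat.card M.State :=
  Nat.card_le_card_of_injective Subtype.val Subtype.val_injective

/-! ### Product, projection and determinization -/

/-- The product is the accessible part of an unnamed automaton. Stating the lemma for a variable `P`
with an equation makes it applicable with `rfl`. -/
theorem runFrom_pair {A : PDFA α} {f : γ → α} {B : PDFA β} {g : γ → β} {P : PDFA γ}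
    (hP : P = { State := A.State × B.State
                finite := inferInstance
                start := (A.start, B.start)
                step := fun q c =>
                  (A.step q.1 (f c)).bind fun q₁ => (B.step q.2 (g c)).map fun q₂ => (q₁, q₂)
                accept := {q | q.1 ∈ A.accept ∧ q.2 ∈ B.accept} })
    {q : A.State} {q' : B.State} {w : List γ} {p : A.State} {p' : B.State} :
    P.runFrom (hP ▸ (q, q')) w = some (hP ▸ (p, p')) ↔
      A.runFrom q (w.map f) = some p ∧ B.runFrom q' (w.map g) = some p' := by
  subst hP
  induction w generalizing q q' with
  | nil => simp [runFrom]
  | cons c w ih =>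
    simp only [runFrom, List.map_cons]
    cases h1 : A.step q (f c) with
    | none => simp
    | some r =>
      cases h2 : B.step q' (g c) with
      | none => simp
      | some r' => simpa using ih

theorem runFrom_product_iff {A : PDFA α} {f : γ → α} {B : PDFA β} {g : γ → β}
    {w : List γ} {p : (product A f B g).State} :
    (product A f B g).runFrom (product A f B g).start w = some p ↔
      A.runFrom A.start (w.map f) = some p.1.1 ∧ B.runFrom B.start (w.map g) = some p.1.2 :=
  runFrom_accessiblePart_iff.trans (runFrom_pair rfl)

theorem exists_runFrom_product {A : PDFA α} {f : γ → α} {B : PDFA β} {g : γ → β}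
    {w : List γ} {p : A.State} {p' : B.State} (h : A.runFrom A.start (w.map f) = some p)
    (h' : B.runFrom B.start (w.map g) = some p') :
    ∃ hp, (product A f B g).runFrom (product A f B g).start w = some ⟨(p, p'), hp⟩ :=
  ⟨⟨w, (runFrom_pair rfl).mpr ⟨h, h'⟩⟩, runFrom_product_iff.mpr ⟨h, h'⟩⟩

theorem mem_language_product {A : PDFA α} {f : γ → α} {B : PDFA β} {g : γ → β} {w : List γ} :
    w ∈ (product A f B g).language ↔ w.map f ∈ A.language ∧ w.map g ∈ B.language := by
  constructor
  · rintro ⟨p, hp, h⟩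
    rw [runFrom_product_iff] at h
    exact ⟨⟨_, hp.1, h.1⟩, ⟨_, hp.2, h.2⟩⟩
  · rintro ⟨⟨p, hp, h⟩, ⟨p', hp', h'⟩⟩
    obtain ⟨hpp, hr⟩ := exists_runFrom_product h h'
    exact ⟨_, ⟨hp, hp'⟩, hr⟩

theorem accessible_product {A : PDFA α} {f : γ → α} {B : PDFA β} {g : γ → β}
    (p : (product A f B g).State) : (product A f B g).Accessible p :=
  accessible_accessiblePart _ p

theorem mem_evalFrom_project {P : PDFA γ} {h : γ → δ} {S : Set P.State} {w : List δ}
    {q : P.State} :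
    q ∈ (P.project h).evalFrom S w ↔
      ∃ s ∈ S, ∃ v : List γ, v.map h = w ∧ P.runFrom s v = some q := by
  induction w generalizing S with
  | nil => simp [runFrom]
  | cons d w ih =>
    rw [NFA.evalFrom_cons, ih]
    constructor
    · rintro ⟨s, hs, v, hv, hq⟩
      obtain ⟨t, ht, c, hc, hts⟩ := NFA.mem_stepSet.mp hs
      exact ⟨t, ht, c :: v, by simp [hc, hv], by simp [runFrom, hts, hq]⟩
    · rintro ⟨s, hs, v, hv, hq⟩
      obtain ⟨c, v, rfl, hc, hv⟩ := List.map_eq_cons_iff.mp hv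
      obtain ⟨t, hst, ht⟩ := Option.bind_eq_some_iff.mp hq
      exact ⟨t, NFA.mem_stepSet.mpr ⟨s, hs, c, hc, hst⟩, v, hv, ht⟩

theorem runFrom_powerset {σ : Type} [Finite σ] (N : NFA δ σ) {S : Set σ} (hS : S.Nonempty)
    {w : List δ} {T : Set σ} :
    (powerset N).runFrom S w = some T ↔ N.evalFrom S w = T ∧ T.Nonempty := by
  induction w generalizing S with
  | nil =>
    rw [NFA.evalFrom_nil]
    exact ⟨fun h => ⟨Option.some.inj h, Option.some.inj h ▸ hS⟩, fun h => congrArg some h.1⟩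
  | cons d w ih =>
    rw [NFA.evalFrom_cons]
    by_cases h : (N.stepSet S d).Nonempty
    · have hstep : (powerset N).step S d = some (N.stepSet S d) := if_pos h
      simp only [runFrom, hstep]
      exact ih h
    · have h0 : N.stepSet S d = ∅ := Set.not_nonempty_iff_eq_empty.mp h
      have he : N.evalFrom ∅ w = ∅ := by
        clear ih h h0
        induction w with
        | nil => rfl
        | cons d w ih => simpa using ih
      have hstep : (powerset N).step S d = none := if_neg h
      simp only [runFrom, hstep, Option.bind_none, h0, he]
      constructor
      · simp
      · rintro ⟨rfl, h⟩
        exact absurd h Set.not_nonempty_empty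

theorem runFrom_determinize_project {P : PDFA γ} {h : γ → δ} {w : List δ}
    {S : (determinize (P.project h)).State}
    (hS : (determinize (P.project h)).runFrom (determinize (P.project h)).start w = some S) :
    members S = {q | ∃ v : List γ, v.map h = w ∧ P.runFrom P.start v = some q} ∧
      (members S).Nonempty := by
  have h1 := (runFrom_powerset (P.project h) (Set.singleton_nonempty P.start)).mp
    (runFrom_accessiblePart_iff.mp hS)
  refine ⟨?_, h1.2⟩
  ext q
  rw [members, ← h1.1, mem_evalFrom_project]
  simp

theorem mem_language_determinize_project {P : PDFA γ} {h : γ → δ} {w : List δ} :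
    w ∈ (determinize (P.project h)).language ↔
      ∃ v : List γ, v.map h = w ∧ v ∈ P.language := by
  constructor
  · rintro ⟨S, ⟨q, hq, hacc⟩, hS⟩
    have h1 := (runFrom_determinize_project hS).1
    have hq' : q ∈ members S := hq
    rw [h1] at hq'
    obtain ⟨v, hv, hr⟩ := hq'
    exact ⟨v, hv, q, hacc, hr⟩
  · rintro ⟨v, hv, q, hacc, hr⟩
    refine mem_language_accessiblePart.mpr ?_
    have hq : q ∈ (P.project h).evalFrom {P.start} w :=
      mem_evalFrom_project.mpr ⟨_, rfl, v, hv, hr⟩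
    exact ⟨_, ⟨q, hq, hacc⟩,
      (runFrom_powerset (P.project h) (Set.singleton_nonempty P.start)).mpr ⟨rfl, q, hq⟩⟩

/-- `P` is deterministic, so a projected transition traversed from a subset is determined by the
subset, one of its elements and the letter of `γ` before projection. -/
theorem subsetTime_project_le [Fintype γ] (P : PDFA γ) (h : γ → δ) {K : ℕ}
    (hK : ∀ S : (determinize (P.project h)).State, (members S).ncard ≤ K) :
    subsetTime (P.project h) ≤
      Nat.card (determinize (P.project h)).State * K * Fintype.card γ := by
  classical
  have := Fintype.ofFinite (determinize (P.project h)).State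
  have := Fintype.ofFinite P.State
  let T : Finset ((_ : (_ : (determinize (P.project h)).State) × P.State) × γ) :=
    (Finset.univ.sigma fun S => (members S).toFinset).sigma fun _ => Finset.univ
  have hT : T.card ≤ Nat.card (determinize (P.project h)).State * K * Fintype.card γ := by
    rw [Finset.card_sigma, Finset.sum_const, smul_eq_mul, Finset.card_univ, Finset.card_sigma,
      Nat.card_eq_fintype_card]
    refine Nat.mul_le_mul_right _ ?_
    refine (Finset.sum_le_card_nsmul _ _ K fun S _ => ?_).trans (by simp)
    rw [← Set.ncard_eq_toFinset_card']
    exact hK S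
  refine le_trans ?_ hT
  rw [subsetTime, ← Set.ncard_coe_finset]
  -- The value `P.start` only makes the map total; it is never used for an actual transition.
  let F : ((_ : (_ : (determinize (P.project h)).State) × P.State) × γ) →
      (determinize (P.project h)).State × P.State × δ × P.State := fun x =>
    (x.1.1, x.1.2, h x.2, (P.step x.1.2 x.2).getD P.start)
  refine (Set.ncard_le_ncard (t := F '' T) ?_ (T.finite_toSet.image F)).trans
    (Set.ncard_image_le T.finite_toSet)
  rintro ⟨S, q, d, p⟩ ⟨hq, c, hc, hs⟩
  refine ⟨⟨⟨S, q⟩, c⟩, ?_, ?_⟩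
  · simpa [T] using hq
  · simp only at hc hs
    simp [F, hc, hs]

/-! ### Hopcroft's partition refinement -/

/-- The block of `r` that contains `p`. -/
def block {Q : Type} (r : Setoid Q) (p : Q) : Set Q := {x | r x p}

theorem block_mem_classes {Q : Type} (r : Setoid Q) (p : Q) : block r p ∈ r.classes := ⟨p, rfl⟩

theorem mem_block_self {Q : Type} (r : Setoid Q) (p : Q) : p ∈ block r p := r.refl' p

theorem eq_block_of_mem {Q : Type} {r : Setoid Q} {Y : Set Q} (hY : Y ∈ r.classes) {p : Q}
    (hp : p ∈ Y) : Y = block r p := by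
  obtain ⟨y, rfl⟩ := hY
  ext x
  exact ⟨fun h => r.trans' h (r.symm' hp), fun h => r.trans' h hp⟩

theorem splitBy_iff {Q : Type} {r : Setoid Q} {X : Set Q} {p q : Q} :
    splitBy r X p q ↔ r p q ∧ (p ∈ X ↔ q ∈ X) := by
  rw [splitBy, Setoid.inf_iff_and, Setoid.ker_def]
  simp

theorem block_splitBy {Q : Type} (r : Setoid Q) (X : Set Q) (p : Q) :
    block (splitBy r X) p = {x ∈ block r p | x ∈ X ↔ p ∈ X} := by
  ext x
  simp [block, splitBy_iff]

theorem block_splitBy_of_mem {Q : Type} (r : Setoid Q) {X : Set Q} {p : Q} (hp : p ∈ X) :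
    block (splitBy r X) p = block r p ∩ X := by
  rw [block_splitBy]
  ext x
  simp [hp]

theorem block_splitBy_of_not_mem {Q : Type} (r : Setoid Q) {X : Set Q} {p : Q} (hp : p ∉ X) :
    block (splitBy r X) p = block r p \ X := by
  rw [block_splitBy]
  ext x
  simp [hp]

theorem splitWorklist_mem_classes {Q : Type} {r : Setoid Q} {W : Set (Set Q × α)} {X : Set Q}
    {z : Set Q × α} (hz : z ∈ splitWorklist r W X) : z.1 ∈ (splitBy r X).classes := by
  obtain ⟨Y, hY, h | h, ⟨p, hp⟩, -⟩ := hz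
  · rw [h] at hp ⊢
    rw [eq_block_of_mem hY hp.1, ← block_splitBy_of_mem r hp.2]
    exact block_mem_classes _ _
  · rw [h] at hp ⊢
    rw [eq_block_of_mem hY hp.1, ← block_splitBy_of_not_mem r hp.2]
    exact block_mem_classes _ _

theorem block_splitBy_mem_splitWorklist {Q : Type} {r : Setoid Q} {W : Set (Set Q × α)}
    (X : Set Q) {p : Q} {b : α} (h : (block r p, b) ∈ W) :
    (block (splitBy r X) p, b) ∈ splitWorklist r W X := by
  refine ⟨block r p, block_mem_classes r p, ?_, ⟨p, mem_block_self _ p⟩, Or.inl h⟩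
  by_cases hp : p ∈ X
  · exact Or.inl (block_splitBy_of_mem r hp)
  · exact Or.inr (block_splitBy_of_not_mem r hp)

theorem smallerPart_eq {Q : Type} (Y X : Set Q) :
    smallerPart Y X = Y ∩ X ∨ smallerPart Y X = Y \ X := by
  rw [smallerPart]
  split <;> simp

theorem ncard_smallerPart_le {Q : Type} [Finite Q] (Y X : Set Q) :
    (smallerPart Y X).ncard ≤ Y.ncard / 2 := by
  have h := Set.ncard_inter_add_ncard_sdiff_eq_ncard Y X (Set.toFinite Y)
  rw [smallerPart]
  split <;> omega

/-! ### Running time of Hopcroft's refinement -/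

section Potential

variable (M : PDFA α)

open Classical in
/-- The credit of the pair of a state and a letter in a configuration of the refinement. -/
noncomputable def credit (s : M.Config) (x : M.State × α) : ℕ :=
  Nat.log 2 (block s.1 x.1).ncard + if (block s.1 x.1, x.2) ∈ s.2 then 1 else 0

/-- One plus the number of transitions with a given letter into a given state. -/
noncomputable def weight (x : M.State × α) : ℕ := 1 + (M.pre {x.1} x.2).ncard

/-- A bound for the remaining time of the refinement. -/
noncomputable def potential [Fintype α] [Fintype M.State] (s : M.Config) : ℕ :=
  ∑ x, M.weight x * M.credit s x

variable {M}

-- Credits never increase, and those of the pairs `(p, a)` with `p ∈ B` drop by at least one. A part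
-- inherited from a waiting block keeps the indicator while its logarithm can only shrink; the
-- removed pair `(B, a)` passes nothing on by inheritance. A part that newly enters the worklist is
-- the smaller one, and its halved size compensates for the indicator.
open Classical in
theorem credit_round {r : Setoid M.State} {W : Set (Set M.State × α)}
    (hW : ∀ z ∈ W, z.1 ∈ r.classes) {B : Set M.State} {a : α} (hB : (B, a) ∈ W)
    (X : Set M.State) (x : M.State × α) :
    M.credit (splitBy r X, splitWorklist r (W \ {(B, a)}) X) x +
      (if x.1 ∈ B ∧ x.2 = a then 1 else 0) ≤ M.credit (r, W) x := by
  obtain ⟨p, b⟩ := x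
  have hthird : (if p ∈ B ∧ b = a then 1 else 0) ≤ if (block r p, b) ∈ W then 1 else 0 := by
    split
    · rename_i h
      rw [← eq_block_of_mem (hW _ hB) h.1, h.2, if_pos hB]
    · simp
  have hlog : Nat.log 2 (block (splitBy r X) p).ncard ≤ Nat.log 2 (block r p).ncard := by
    refine Nat.log_mono_right (Set.ncard_le_ncard ?_ (Set.toFinite _))
    rw [block_splitBy]
    exact Set.sep_subset _ _
  simp only [credit]
  by_cases h : (block (splitBy r X) p, b) ∈ splitWorklist r (W \ {(B, a)}) X
  · rw [if_pos h]
    obtain ⟨Y, hY, hz, -, hor⟩ := h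
    simp only at hz hor
    have hpp : p ∈ block (splitBy r X) p := mem_block_self _ p
    have hpY : p ∈ Y := by
      rcases hz with hz | hz <;> rw [hz] at hpp <;> exact hpp.1
    have hYp := eq_block_of_mem hY hpY
    subst hYp
    rcases hor with hmem | ⟨⟨u, hu⟩, ⟨v, hv⟩, hsmall⟩
    · have hne : ¬ (p ∈ B ∧ b = a) := by
        rintro ⟨h1, rfl⟩
        exact hmem.2 (congrArg (·, b) (eq_block_of_mem (hW _ hB) h1).symm)
      rw [if_neg hne, if_pos hmem.1]
      omega
    -- The block is really split, so it has at least two elements and its logarithm is positive;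
    -- passing to at most half the size costs a full unit, also when the block is `B` itself.
    · have h1 := ncard_smallerPart_le (block r p) X
      rw [← hsmall] at h1
      have h2 := Nat.log_mono_right (b := 2) h1
      rw [Nat.log_div_base] at h2
      have h3 : 2 ≤ (block r p).ncard := by
        rw [← Nat.lt_iff_add_one_le, Set.one_lt_ncard_iff]
        exact ⟨u, v, hu.1, hv.1, fun h => hv.2 (h ▸ hu.2)⟩
      have h4 := Nat.log_pos one_lt_two h3
      omega
  · rw [if_neg h]
    omega

theorem le_sum_weight [Fintype M.State] (B : Set M.State) (hB : B.Nonempty) (a : α)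
    [DecidablePred (· ∈ B)] :
    1 + (M.pre B a).ncard ≤ ∑ p with p ∈ B, M.weight (p, a) := by
  simp only [weight]
  rw [Finset.sum_add_distrib]
  refine add_le_add ?_ ?_
  · obtain ⟨p, hp⟩ := hB
    simp only [Finset.sum_const, smul_eq_mul, mul_one]
    exact Finset.card_pos.mpr ⟨p, by simpa using hp⟩
  · refine le_trans (le_of_eq ?_) (Finset.set_ncard_biUnion_le _ _)
    congr 1
    ext q
    simp [pre]

/-- By determinism, for a fixed letter each state is counted in at most one in-degree. -/
theorem sum_weight_le [Fintype α] [Fintype M.State] :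
    ∑ x, M.weight x ≤ 2 * (Fintype.card M.State * Fintype.card α) := by
  classical
  simp only [weight]
  rw [Finset.sum_add_distrib, two_mul]
  refine add_le_add (by simp) ?_
  rw [Fintype.sum_prod_type_right, mul_comm]
  refine (Finset.sum_le_card_nsmul _ _ (Fintype.card M.State) fun a _ => ?_).trans (by simp)
  have h : ∀ p, (M.pre {p} a).ncard = (Finset.univ.filter fun q => M.step q a = some p).card := by
    intro p
    rw [← Set.ncard_coe_finset]
    congr 1
    ext q
    simp [pre]
  simp only [h]
  rw [← Finset.card_biUnion]
  · exact Finset.card_le_univ _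
  · intro p _ p' _ hpp
    rw [Function.onFun, Finset.disjoint_left]
    intro q h1 h2
    simp only [Finset.mem_filter, Finset.mem_univ, true_and] at h1 h2
    exact hpp (Option.some.inj (h1.symm.trans h2))

/-- The round costs at most the total weight of the pairs `(p, a)` with `p ∈ B`, each of which loses
one unit of credit. The splitting set `X` is irrelevant for this. -/
theorem potential_round [Fintype α] [Fintype M.State] {r : Setoid M.State}
    {W : Set (Set M.State × α)} (hW : ∀ z ∈ W, z.1 ∈ r.classes) {B : Set M.State} {a : α}
    (hB : (B, a) ∈ W) (X : Set M.State) :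
    1 + (M.pre B a).ncard + M.potential (splitBy r X, splitWorklist r (W \ {(B, a)}) X) ≤
      M.potential (r, W) := by
  classical
  have hne : B.Nonempty := by
    obtain ⟨y, hy⟩ := hW _ hB
    simp only at hy
    exact ⟨y, by rw [hy]; exact r.refl' y⟩
  have h1 := le_sum_weight B hne a
  have h2 : ∑ p with p ∈ B, M.weight (p, a) =
      ∑ x, M.weight x * (if x.1 ∈ B ∧ x.2 = a then 1 else 0) := by
    rw [Fintype.sum_prod_type, Finset.sum_filter]
    refine Finset.sum_congr rfl fun p _ => ?_
    by_cases hp : p ∈ B <;> simp [hp]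
  rw [h2] at h1
  refine (Nat.add_le_add_right h1 _).trans ?_
  rw [potential, potential, ← Finset.sum_add_distrib]
  refine Finset.sum_le_sum fun x _ => ?_
  rw [← mul_add, add_comm]
  exact Nat.mul_le_mul_left _ (credit_round hW hB X x)

theorem HopcroftRun.time_le [Fintype α] [Fintype M.State] {s : M.Config} {r' : Setoid M.State}
    {t : ℕ} (h : HopcroftRun M s r' t) (hW : ∀ z ∈ s.2, z.1 ∈ s.1.classes) :
    t ≤ M.potential s := by
  induction h with
  | done r => exact Nat.zero_le _
  | round r r' W B a t hB h ih =>
    have h1 := ih fun z hz => splitWorklist_mem_classes hz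
    have h2 := potential_round (r := r) (W := W) hW hB (M.pre B a)
    omega

/-- Every round costs at least one, so the potential strictly decreases; with potential zero the
worklist must be empty. -/
theorem exists_hopcroftRun [Fintype α] [Fintype M.State] (n : ℕ) (s : M.Config)
    (hs : M.potential s ≤ n) (hW : ∀ z ∈ s.2, z.1 ∈ s.1.classes) :
    ∃ r t, HopcroftRun M s r t := by
  induction n generalizing s with
  | zero =>
    obtain ⟨r, W⟩ := s
    rcases W.eq_empty_or_nonempty with rfl | ⟨⟨B, a⟩, hB⟩
    · exact ⟨r, 0, .done r⟩
    · have := potential_round (r := r) (W := W) hW hB ∅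
      omega
  | succ n ih =>
    obtain ⟨r, W⟩ := s
    rcases W.eq_empty_or_nonempty with rfl | ⟨⟨B, a⟩, hB⟩
    · exact ⟨r, 0, .done r⟩
    · have h := potential_round (r := r) (W := W) hW hB (M.pre B a)
      obtain ⟨r', t, ht⟩ := ih (splitBy r (M.pre B a), splitWorklist r (W \ {(B, a)}) (M.pre B a))
        (by omega) fun z hz => splitWorklist_mem_classes hz
      exact ⟨r', _, .round r r' W B a t hB ht⟩

theorem potential_le [Fintype α] [Fintype M.State] (s : M.Config) :
    M.potential s ≤
      2 * (Fintype.card M.State * Fintype.card α) * (Nat.log 2 (Fintype.card M.State) + 1) := by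
  refine le_trans ?_ (Nat.mul_le_mul_right _ sum_weight_le)
  rw [potential, Finset.sum_mul]
  refine Finset.sum_le_sum fun x _ => Nat.mul_le_mul_left _ ?_
  refine add_le_add (Nat.log_mono_right ?_) (by split <;> simp)
  rw [← Nat.card_eq_fintype_card]
  exact Set.ncard_le_card _

end Potential

/-! ### Correctness of Hopcroft's refinement -/

section Correctness

variable {M : PDFA α}

/-- `r` is compatible with the transitions and the accepting states, and it relates all states
that accept the same words. -/
structure IsNerode (M : PDFA α) (r : Setoid M.State) : Prop where
  step : ∀ q q' a p, r q q' → M.step q a = some p → ∃ p', M.step q' a = some p' ∧ r p p'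
  accept : ∀ q q', r q q' → (q ∈ M.accept ↔ q' ∈ M.accept)
  of_acceptsFrom : ∀ q q', (∀ w, M.AcceptsFrom q w ↔ M.AcceptsFrom q' w) → r q q'

/-- The invariant of the refinement: blocks that are not yet stable can still be separated by a
splitter in the worklist. -/
structure HopcroftInvariant (M : PDFA α) (s : M.Config) : Prop where
  mem_classes : ∀ z ∈ s.2, z.1 ∈ s.1.classes
  step : ∀ q q' a p, s.1 q q' → M.step q a = some p →
    (∃ p', M.step q' a = some p' ∧ s.1 p p') ∨
      ∃ B, (B, a) ∈ s.2 ∧ ¬ (q ∈ M.pre B a ↔ q' ∈ M.pre B a)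
  accept : ∀ q q', s.1 q q' → (q ∈ M.accept ↔ q' ∈ M.accept)
  of_acceptsFrom : ∀ q q', (∀ w, M.AcceptsFrom q w ↔ M.AcceptsFrom q' w) → s.1 q q'

theorem mem_pre_iff {B : Set M.State} {q p : M.State} {a : α} (h : M.step q a = some p) :
    q ∈ M.pre B a ↔ p ∈ B := by
  simp [pre, h]

/-- Splitting never separates equivalent states. Absence of dead states is essential: an undefined
transition and one into a dead state accept the same words, but are distinguished by the refinement.
-/
theorem mem_pre_of_acceptsFrom_iff (hco : ∀ q, M.Coaccessible q) {r : Setoid M.State}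
    (hr : ∀ q q', (∀ w, M.AcceptsFrom q w ↔ M.AcceptsFrom q' w) → r q q') {B : Set M.State}
    (hB : B ∈ r.classes) {a : α} {q q' : M.State}
    (h : ∀ w, M.AcceptsFrom q w ↔ M.AcceptsFrom q' w) (hq : q ∈ M.pre B a) :
    q' ∈ M.pre B a := by
  obtain ⟨p, hp, hs⟩ := hq
  have hs' : M.runFrom q [a] = some p := by simp [runFrom, hs]
  obtain ⟨w, hw⟩ := hco p
  obtain ⟨p', hp', -⟩ := exists_runFrom_of_acceptsFrom_append
    ((h _).mp ((acceptsFrom_of_runFrom hs' w).mp hw))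
  have hstep : M.step q' a = some p' := by simpa [runFrom] using hp'
  refine ⟨p', ?_, hstep⟩
  have hpp : r p p' := hr _ _ fun v => by
    rw [acceptsFrom_of_runFrom hs', acceptsFrom_of_runFrom hp', h]
  rw [eq_block_of_mem hB hp]
  exact r.symm' hpp

/-- Suppose the successors `p` and `p'` lay in one block and `X` has just separated them. If that
block was waiting, both of its parts are waiting now. Otherwise only the smaller part is queued,
which is enough, as it contains exactly one of the two. Now suppose that `q` and `q'` were separated
by a waiting splitter. It cannot be `(B, a)`, by which they have just been compared, so its parts
remain in the worklist, and the part that contains the successor inside it still separates them. -/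
theorem HopcroftInvariant.round (hco : ∀ q, M.Coaccessible q) {r : Setoid M.State}
    {W : Set (Set M.State × α)} (hs : HopcroftInvariant M (r, W)) {B : Set M.State} {a : α}
    (hB : (B, a) ∈ W) :
    HopcroftInvariant M
      (splitBy r (M.pre B a), splitWorklist r (W \ {(B, a)}) (M.pre B a)) where
  mem_classes z hz := splitWorklist_mem_classes hz
  accept q q' h := hs.accept q q' (splitBy_iff.mp h).1
  of_acceptsFrom q q' h := splitBy_iff.mpr ⟨hs.of_acceptsFrom q q' h,
    mem_pre_of_acceptsFrom_iff hco hs.of_acceptsFrom (hs.mem_classes _ hB) h,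
    mem_pre_of_acceptsFrom_iff hco hs.of_acceptsFrom (hs.mem_classes _ hB) fun w => (h w).symm⟩
  step q q' b p hqq hp := by
    simp only at hqq ⊢
    obtain ⟨hqr, hX⟩ := splitBy_iff.mp hqq
    set X := M.pre B a
    rcases hs.step q q' b p hqr hp with ⟨p', hp', hpp⟩ | ⟨B', hB', hsep⟩
    · by_cases hX' : p ∈ X ↔ p' ∈ X
      · exact Or.inl ⟨p', hp', splitBy_iff.mpr ⟨hpp, hX'⟩⟩
      right
      by_cases hmem : (block r p, b) ∈ W \ {(B, a)}
      · refine ⟨_, block_splitBy_mem_splitWorklist X hmem, ?_⟩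
        rw [mem_pre_iff hp, mem_pre_iff hp']
        intro h
        have h1 : p ∈ block (splitBy r X) p := mem_block_self _ p
        have h2 := h.mp h1
        exact hX' (splitBy_iff.mp h2).2.symm
      · have hpY : p ∈ block r p := r.refl' p
        have hpY' : p' ∈ block r p := r.symm' hpp
        have hne : (block r p ∩ X).Nonempty ∧ (block r p \ X).Nonempty := by
          by_cases h1 : p ∈ X
          · exact ⟨⟨p, hpY, h1⟩, ⟨p', hpY', fun h2 => hX' ⟨fun _ => h2, fun _ => h1⟩⟩⟩
          · refine ⟨⟨p', hpY', ?_⟩, ⟨p, hpY, h1⟩⟩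
            by_contra h2
            exact hX' ⟨fun h => absurd h h1, fun h => absurd h h2⟩
        refine ⟨smallerPart (block r p) X, ⟨block r p, block_mem_classes r p,
          smallerPart_eq _ _, ?_, Or.inr ⟨hne.1, hne.2, rfl⟩⟩, ?_⟩
        · rcases smallerPart_eq (block r p) X with h | h <;> rw [h]
          exacts [hne.1, hne.2]
        · rw [mem_pre_iff hp, mem_pre_iff hp']
          rcases smallerPart_eq (block r p) X with h | h <;> rw [h]
          · simpa [hpY, hpY'] using hX'
          · simpa [hpY, hpY', not_iff_not] using hX'
    · right
      have hne : (B', b) ≠ (B, a) := by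
        intro h
        simp only [Prod.mk.injEq] at h
        obtain ⟨rfl, rfl⟩ := h
        exact hsep hX
      have hcl : B' ∈ r.classes := hs.mem_classes _ hB'
      have key : ∀ u u' : M.State, u ∈ M.pre B' b → u' ∉ M.pre B' b →
          ∃ Z, (Z, b) ∈ splitWorklist r (W \ {(B, a)}) X ∧ u ∈ M.pre Z b ∧ u' ∉ M.pre Z b := by
        rintro u u' ⟨v, hv, huv⟩ hu'
        have hv' := eq_block_of_mem hcl hv
        refine ⟨block (splitBy r X) v, block_splitBy_mem_splitWorklist X (hv' ▸ ⟨hB', hne⟩),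
          ⟨v, mem_block_self _ v, huv⟩, ?_⟩
        rintro ⟨v', hv1, hv2⟩
        refine hu' ⟨v', ?_, hv2⟩
        rw [hv']
        exact (splitBy_iff.mp hv1).1
      by_cases h1 : q ∈ M.pre B' b
      · obtain ⟨Z, hZ, h3, h4⟩ := key q q' h1 fun h2 => hsep ⟨fun _ => h2, fun _ => h1⟩
        exact ⟨Z, hZ, fun h => h4 (h.mp h3)⟩
      · have h2 : q' ∈ M.pre B' b := by
          by_contra h2
          exact hsep ⟨fun h => absurd h h1, fun h => absurd h h2⟩
        obtain ⟨Z, hZ, h3, h4⟩ := key q' q h2 h1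
        exact ⟨Z, hZ, fun h => h4 (h.mpr h3)⟩

/-- All blocks are waiting with all letters, so the block of the successor `p` itself serves as a
separating splitter. -/
theorem hopcroftInvariant_init (M : PDFA α) : HopcroftInvariant M M.hopcroftInit where
  mem_classes z hz := hz
  step q q' a p hqq hp := by
    set r : Setoid M.State := Setoid.ker fun q => q ∈ M.accept
    by_cases h : ∃ p', M.step q' a = some p' ∧ r p p'
    · exact Or.inl h
    · refine Or.inr ⟨block r p, block_mem_classes r p, ?_⟩
      rw [mem_pre_iff hp]
      intro hiff
      obtain ⟨p', h1, h2⟩ := hiff.mp (r.refl' p)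
      exact h ⟨p', h2, r.symm' h1⟩
  accept q q' h := by
    rw [hopcroftInit, Setoid.ker_def] at h
    exact iff_of_eq h
  of_acceptsFrom q q' h := by
    rw [hopcroftInit, Setoid.ker_def]
    simpa [AcceptsFrom, runFrom] using h []

theorem HopcroftRun.isNerode (hco : ∀ q, M.Coaccessible q) {s : M.Config}
    {r' : Setoid M.State} {t : ℕ} (h : HopcroftRun M s r' t) (hs : HopcroftInvariant M s) :
    M.IsNerode r' := by
  induction h with
  | done r =>
    refine ⟨fun q q' a p h1 h2 => ?_, hs.accept, hs.of_acceptsFrom⟩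
    rcases hs.step q q' a p h1 h2 with h | ⟨B, hB, -⟩
    · exact h
    · exact absurd hB (Set.notMem_empty _)
  | round r r' W B a t hB h ih => exact ih (hs.round hco hB)

/-! ### The quotient by the computed partition -/

/-- Compatibility in both directions makes the transition, including its being undefined,
independent of the representative chosen by `Quotient.out`. -/
theorem step_quotient {r : Setoid M.State} (hr : M.IsNerode r) (q : M.State) (a : α) :
    (M.quotient r).step (Quotient.mk r q) a = (M.step q a).map (Quotient.mk r) := by
  have hout : r (Quotient.mk r q).out q := Quotient.mk_out q
  simp only [quotient]
  cases h : M.step q a with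
  | some p =>
    obtain ⟨p', hp', hpp⟩ := hr.step _ _ a p (r.symm' hout) h
    rw [hp']
    exact congrArg some (Quotient.sound (r.symm' hpp))
  | none =>
    cases h' : M.step (Quotient.mk r q).out a with
    | none => rfl
    | some p =>
      obtain ⟨p', hp', -⟩ := hr.step _ _ a p hout h'
      simp [h] at hp'

theorem runFrom_quotient {r : Setoid M.State} (hr : M.IsNerode r) (q : M.State) (w : List α) :
    (M.quotient r).runFrom (Quotient.mk r q) w = (M.runFrom q w).map (Quotient.mk r) := by
  induction w generalizing q with
  | nil => rfl
  | cons a w ih =>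
    simp only [runFrom]
    rw [step_quotient hr]
    cases h : M.step q a with
    | none => rfl
    | some p => exact ih p

theorem acceptsFrom_quotient {r : Setoid M.State} (hr : M.IsNerode r) (q : M.State)
    (w : List α) : (M.quotient r).AcceptsFrom (Quotient.mk r q) w ↔ M.AcceptsFrom q w := by
  constructor
  · rintro ⟨_, ⟨p, hp, rfl⟩, hw⟩
    rw [runFrom_quotient hr] at hw
    obtain ⟨p', h1, h2⟩ := Option.map_eq_some_iff.mp hw
    exact ⟨p', (hr.accept _ _ (Quotient.exact h2)).mpr hp, h1⟩
  · rintro ⟨p, hp, hw⟩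
    exact ⟨Quotient.mk r p, ⟨p, hp, rfl⟩, by rw [runFrom_quotient hr, hw]; rfl⟩

theorem isMinimal_quotient {r : Setoid M.State} (hr : M.IsNerode r)
    (hacc : ∀ q, M.Accessible q) (hco : ∀ q, M.Coaccessible q) : (M.quotient r).IsMinimal := by
  constructor
  · intro c
    obtain ⟨q, rfl⟩ := Quotient.exists_rep c
    constructor
    · obtain ⟨w, hw⟩ := hacc q
      exact ⟨w, (runFrom_quotient hr M.start w).trans (by rw [hw]; rfl)⟩
    · obtain ⟨w, hw⟩ := hco q
      exact ⟨w, (acceptsFrom_quotient hr q w).mpr hw⟩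
  · intro c c' h
    obtain ⟨q, rfl⟩ := Quotient.exists_rep c
    obtain ⟨q', rfl⟩ := Quotient.exists_rep c'
    refine Quotient.sound (hr.of_acceptsFrom q q' fun w => ?_)
    rw [← acceptsFrom_quotient hr, ← acceptsFrom_quotient hr]
    exact h w

end Correctness

/-! ### Minimization and the combination of two automata -/

theorem exists_minimizes [Fintype α] (M : PDFA α) : ∃ M' t, M.Minimizes M' t := by
  have := Fintype.ofFinite M.trim.State
  obtain ⟨r, t, h⟩ := exists_hopcroftRun _ M.trim.hopcroftInit le_rfl fun z hz => hz
  exact ⟨_, _, r, t, h, rfl, rfl⟩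

theorem Minimizes.time_le [Fintype α] {M M' : PDFA α} {t : ℕ} (h : M.Minimizes M' t) {N : ℕ}
    (hN : Nat.card M.State ≤ N) :
    t ≤ N * (1 + Fintype.card α) + 2 * (N * Fintype.card α) * (Nat.log 2 N + 1) := by
  obtain ⟨r, t', ht', -, rfl⟩ := h
  have := Fintype.ofFinite M.trim.State
  have hN' : Fintype.card M.trim.State ≤ N := by
    rw [← Nat.card_eq_fintype_card]
    exact M.card_trim_le.trans hN
  refine add_le_add (M.size_le.trans (Nat.mul_le_mul_right _ hN)) ?_
  refine (ht'.time_le fun z hz => hz).trans ((potential_le _).trans ?_)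
  have := Nat.log_mono_right (b := 2) hN'
  gcongr

theorem Minimizes.spec {M M' : PDFA α} {t : ℕ} (h : M.Minimizes M' t)
    (hacc : ∀ q, M.Accessible q) (hne : ∃ w, w ∈ M.language) :
    M'.IsMinimal ∧ ∀ w, w ∈ M'.language ↔ w ∈ M.language := by
  obtain ⟨r, t', ht', rfl, -⟩ := h
  have hco := coaccessible_trim hne
  have hr := ht'.isNerode hco (hopcroftInvariant_init _)
  exact ⟨isMinimal_quotient hr (accessible_trim hacc) hco, fun w =>
    (acceptsFrom_quotient hr _ w).trans mem_language_trim⟩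

theorem exists_combine [Fintype δ] (A : PDFA α) (f : γ → α) (B : PDFA β) (g : γ → β)
    (h : γ → δ) : ∃ M t, Combine A f B g h M t := by
  obtain ⟨M, t, hM⟩ := exists_minimizes (determinize (project (product A f B g) h))
  exact ⟨M, _, t, hM, rfl⟩

theorem Combine.spec {A : PDFA α} {f : γ → α} {B : PDFA β} {g : γ → β} {h : γ → δ}
    {M : PDFA δ} {t : ℕ} (hM : Combine A f B g h M t) {L : Language δ} (hne : ∃ w, w ∈ L)
    (hL : ∀ w, w ∈ L ↔ ∃ v : List γ, v.map h = w ∧ v.map f ∈ A.language ∧ v.map g ∈ B.language) :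
    M.IsMinimal ∧ M.language = L := by
  obtain ⟨t', ht', -⟩ := hM
  have hdet : ∀ w, w ∈ (determinize (project (product A f B g) h)).language ↔ w ∈ L := by
    intro w
    rw [hL, mem_language_determinize_project]
    simp only [mem_language_product]
  obtain ⟨w, hw⟩ := hne
  have h1 := ht'.spec (accessible_accessiblePart _) ⟨w, (hdet w).mpr hw⟩
  exact ⟨h1.1, Set.ext fun w => (h1.2 w).trans (hdet w)⟩

theorem Combine.time_le [Fintype γ] [Fintype δ] {A : PDFA α} {f : γ → α} {B : PDFA β}
    {g : γ → β} {h : γ → δ} {M : PDFA δ} {t : ℕ} (hM : Combine A f B g h M t) {N K : ℕ}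
    (hP : Nat.card (product A f B g).State ≤ N)
    (hD : Nat.card (determinize (project (product A f B g) h)).State ≤ N)
    (hK : ∀ S : (determinize (project (product A f B g) h)).State, (members S).ncard ≤ K) :
    t ≤ N * (1 + 2 * Fintype.card γ + K * Fintype.card γ + (1 + Fintype.card δ) +
      2 * Fintype.card δ * (Nat.log 2 N + 1)) := by
  obtain ⟨t', ht', rfl⟩ := hM
  have h1 := (product A f B g).size_le.trans (Nat.mul_le_mul_right _ hP)
  have h2 := (product A f B g).numTransitions_le.trans (Nat.mul_le_mul_right _ hP)
  have h3 := (subsetTime_project_le (product A f B g) h hK).trans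
    (Nat.mul_le_mul_right _ (Nat.mul_le_mul_right _ hD))
  have h4 := ht'.time_le hD
  calc _ ≤ _ := add_le_add (add_le_add (add_le_add h1 h2) h3) h4
    _ = _ := by ring

end PDFA

namespace Fibonacci

open PDFA Real

variable {α β γ δ : Type}

/-! ### Sums of Fibonacci numbers with integer digits -/

/-- The sum `∑ k(wᵢ) F_{i+j}`, where `i` is the distance of a letter to the end of the word `w`. -/
def fibSum (j : ℕ) (k : α → ℤ) : List α → ℤ
  | [] => 0
  | a :: w => k a * Nat.fib (w.length + j) + fibSum j k w

theorem fibSum_map (j : ℕ) (k : α → ℤ) (f : γ → α) (w : List γ) :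
    fibSum j k (w.map f) = fibSum j (fun c => k (f c)) w := by
  induction w with
  | nil => rfl
  | cons a w ih => simp [fibSum, ih]

theorem fibSum_linear {j : ℕ} {k k₁ k₂ : α → ℤ} {p q : ℤ} (h : ∀ a, k a = p * k₁ a + q * k₂ a)
    (w : List α) : fibSum j k w = p * fibSum j k₁ w + q * fibSum j k₂ w := by
  induction w with
  | nil => simp [fibSum]
  | cons a w ih =>
    simp only [fibSum, ih, h]
    ring

theorem fibSum_concat (k : α → ℤ) (w : List α) (a : α) :
    fibSum 2 k (w ++ [a]) = fibSum 3 k w + k a := by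
  induction w with
  | nil => simp [fibSum]
  | cons b w ih =>
    simp only [List.cons_append, fibSum, ih, List.length_append, List.length_singleton]
    ring

theorem fibSum_shift_concat (k : α → ℤ) (w : List α) (a : α) :
    fibSum 3 k (w ++ [a]) = fibSum 2 k w + fibSum 3 k w + 2 * k a := by
  induction w with
  | nil => simp [fibSum, show Nat.fib 3 = 2 from rfl]; ring
  | cons b w ih =>
    simp only [List.cons_append, fibSum, ih, List.length_append, List.length_singleton]
    rw [show w.length + 1 + 3 = (w.length + 2) + 2 by ring, Nat.fib_add_two]
    push_cast
    ring

/-- The pair of the sum and the shifted sum is transformed by each appended letter in a way that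
depends only on the digit of that letter. -/
theorem fibSum_append_congr {k : α → ℤ} {w w' : List α} (h2 : fibSum 2 k w = fibSum 2 k w')
    (h3 : fibSum 3 k w = fibSum 3 k w') (v : List α) :
    fibSum 2 k (w ++ v) = fibSum 2 k (w' ++ v) := by
  induction v generalizing w w' with
  | nil => simpa using h2
  | cons a v ih =>
    rw [List.append_cons, List.append_cons w']
    refine ih ?_ ?_
    · rw [fibSum_concat, fibSum_concat, h3]
    · rw [fibSum_shift_concat, fibSum_shift_concat, h2, h3]

/-- The error of the approximation of a shifted sum by `φ` times the sum. -/
noncomputable def shiftError (k : α → ℤ) (w : List α) : ℝ :=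
  fibSum 3 k w - goldenRatio * fibSum 2 k w

theorem shiftError_concat (k : α → ℤ) (w : List α) (a : α) :
    shiftError k (w ++ [a]) =
      (1 - goldenRatio) * shiftError k w + (2 - goldenRatio) * k a := by
  simp only [shiftError, fibSum_concat, fibSum_shift_concat]
  push_cast
  linear_combination (-(fibSum 2 k w : ℝ)) * goldenRatio_sq

theorem goldenRatio_bounds : (1.618 : ℝ) < goldenRatio ∧ goldenRatio < 1.619 := by
  have h := goldenRatio_sq
  have h1 := one_lt_goldenRatio
  constructor <;> nlinarith

/-- A letter multiplies the error by `1 - φ` and adds `2 - φ` times its digit, and `|1 - φ| + |2 -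
φ| = 1`. -/
theorem abs_shiftError_le {k : α → ℤ} {P : ℕ} (hk : ∀ a, |k a| ≤ P) (w : List α) :
    |shiftError k w| ≤ P := by
  obtain ⟨h1, h2⟩ := goldenRatio_bounds
  induction w using List.reverseRecOn with
  | nil =>
    simp [shiftError, fibSum]
  | append_singleton w a ih =>
    rw [shiftError_concat]
    have h3 := abs_le.mp ih
    have hka : |(k a : ℝ)| ≤ P := by exact_mod_cast hk a
    have h4 := abs_le.mp hka
    rw [abs_le]
    constructor <;> nlinarith

/-- The value of a binary digit. -/
def digit (a : Fin 2) : ℤ := ((a : ℕ) : ℤ)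

theorem digit_eq (a : Fin 2) : a = 0 ∧ digit a = 0 ∨ a = 1 ∧ digit a = 1 := by
  fin_cases a <;> simp [digit]

theorem coe_value (x : List (Fin 2)) : (value x : ℤ) = fibSum 2 digit x := by
  induction x with
  | nil => rfl
  | cons a x ih => simp [value, fibSum, digit, ih]

/-- The open interval from `φ - 2` to `φ - 1` contains 0 and is mapped into itself by `e ↦ (1 - φ) *
e` and `e ↦ (1 - φ) * e + (2 - φ)`. It has length one, so it determines the shifted value from the
value, even for words that are not valid. -/
theorem shiftError_digit_bounds (x : List (Fin 2)) :
    goldenRatio - 2 < shiftError digit x ∧ shiftError digit x < goldenRatio - 1 := by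
  obtain ⟨h1, h2⟩ := goldenRatio_bounds
  have hsq := goldenRatio_sq
  induction x using List.reverseRecOn with
  | nil =>
    simp only [shiftError, fibSum, Int.cast_zero]
    constructor <;> linarith
  | append_singleton x a ih =>
    have h3 := mul_pos (sub_pos.mpr one_lt_goldenRatio) (sub_pos.mpr ih.1)
    have h4 := mul_pos (sub_pos.mpr one_lt_goldenRatio) (sub_pos.mpr ih.2)
    rw [shiftError_concat]
    rcases digit_eq a with ⟨-, h⟩ | ⟨-, h⟩ <;> rw [h] <;> push_cast <;>
      constructor <;> nlinarith

/-- Used for the automata of `[x] = 0` and `[x] = 1`: a positive value becomes at least 2 after any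
further digit. -/
theorem fibSum_digit (x : List (Fin 2)) :
    fibSum 2 digit x = 0 ∧ fibSum 3 digit x = 0 ∨
      0 < fibSum 2 digit x ∧ fibSum 2 digit x < fibSum 3 digit x := by
  induction x with
  | nil => simp [fibSum]
  | cons a x ih =>
    have h1 : 0 < Nat.fib (x.length + 2) := Nat.fib_pos.mpr (by omega)
    have h2 : Nat.fib (x.length + 2) < Nat.fib (x.length + 3) := Nat.fib_lt_fib_succ (by omega)
    rcases digit_eq a with ⟨-, h⟩ | ⟨-, h⟩ <;> simp only [fibSum, h]
    · simpa using ih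
    · omega

/-! ### Valid representations -/

theorem Valid.nil : Valid [] := List.isChain_nil

theorem valid_concat {x : List (Fin 2)} {a : Fin 2} :
    Valid (x ++ [a]) ↔ Valid x ∧ (a = 1 → x.getLast? ≠ some 1) := by
  rw [Valid, Valid, List.isChain_append]
  simp only [List.isChain_singleton, List.head?_cons, Option.mem_def, Option.some.injEq,
    forall_eq', true_and]
  refine and_congr_right fun _ => ⟨fun h ha hx => h 1 hx ⟨rfl, ha⟩, ?_⟩
  rintro h b hb ⟨rfl, ha⟩
  exact h ha hb

theorem valid_zero_cons {x : List (Fin 2)} : Valid (0 :: x) ↔ Valid x := by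
  simp [Valid, List.isChain_cons]

theorem valid_one_zero_cons {x : List (Fin 2)} : Valid (1 :: 0 :: x) ↔ Valid x := by
  simp [Valid, List.isChain_cons]

theorem value_lt {x : List (Fin 2)} (hx : Valid x) : value x < Nat.fib (x.length + 2) := by
  induction x using List.twoStepInduction with
  | nil => simp [value]
  | singleton a => fin_cases a <;> simp [value, show Nat.fib 3 = 2 from rfl]
  | cons_cons a b x ih1 ih2 =>
    rcases digit_eq a with ⟨rfl, -⟩ | ⟨rfl, -⟩
    · have h := ih2 b (valid_zero_cons.mp hx)
      have h' : Nat.fib ((b :: x).length + 2) ≤ Nat.fib ((0 :: b :: x : List (Fin 2)).length + 2) :=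
        Nat.fib_mono (by simp)
      simp only [value, Fin.val_zero, zero_mul, zero_add] at h ⊢
      exact h.trans_le h'
    · rcases digit_eq b with ⟨rfl, -⟩ | ⟨rfl, -⟩
      · have h := ih1 (valid_one_zero_cons.mp hx)
        simp only [value, Fin.val_zero, Fin.val_one, zero_mul, zero_add, one_mul,
          List.length_cons]
        have hfib := Nat.fib_add_two (n := x.length + 2)
        rw [show x.length + 1 + 1 + 2 = x.length + 2 + 2 by ring, hfib,
          show x.length + 1 + 2 = x.length + 2 + 1 by ring]
        omega
      · simp [Valid, List.isChain_cons] at hx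

theorem Valid.of_cons {a : Fin 2} {x : List (Fin 2)} (h : Valid (a :: x)) : Valid x :=
  (List.isChain_cons.mp h).2

theorem Valid.eq_of_value_eq {x y : List (Fin 2)} (hx : Valid x) (hy : Valid y)
    (hlen : x.length = y.length) (h : value x = value y) : x = y := by
  induction x generalizing y with
  | nil => exact (List.length_eq_zero_iff.mp hlen.symm).symm
  | cons a x ih =>
    obtain _ | ⟨b, y⟩ := y
    · simp at hlen
    have hlen' : x.length = y.length := by simpa using hlen
    have h1 := value_lt hx.of_cons
    have h2 := value_lt hy.of_cons
    rw [value, value, hlen'] at h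
    rw [hlen'] at h1
    have hab : a = b := by
      rcases digit_eq a with ⟨rfl, -⟩ | ⟨rfl, -⟩ <;> rcases digit_eq b with ⟨rfl, -⟩ | ⟨rfl, -⟩ <;>
        simp at h ⊢ <;> omega
    subst hab
    rw [ih hx.of_cons hy.of_cons hlen' (Nat.add_left_cancel h)]

theorem exists_valid_value_eq (L : ℕ) {Y : ℕ} (hY : Y < Nat.fib (L + 2)) :
    ∃ x, x.length = L ∧ Valid x ∧ value x = Y := by
  induction L using Nat.twoStepInduction generalizing Y with
  | zero => exact ⟨[], rfl, Valid.nil, by simp [value] at hY ⊢; omega⟩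
  | one =>
    have hY2 : Y < 2 := hY
    exact ⟨[⟨Y, hY2⟩], rfl, List.isChain_singleton _, by simp [value]⟩
  | more L ih1 ih2 =>
    by_cases h : Y < Nat.fib (L + 1 + 2)
    · obtain ⟨x, h1, h2, h3⟩ := ih2 h
      exact ⟨0 :: x, by simp [h1], valid_zero_cons.mpr h2, by simp [value, h3]⟩
    · rw [show L + 2 + 2 = (L + 2) + 2 from rfl, Nat.fib_add_two,
        show L + 2 + 1 = L + 1 + 2 by ring] at hY
      obtain ⟨x, h1, h2, h3⟩ := ih1 (Y := Y - Nat.fib (L + 1 + 2)) (by omega)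
      refine ⟨1 :: 0 :: x, by simp [h1], valid_one_zero_cons.mpr h2, ?_⟩
      simp only [value, List.length_cons, h1, Fin.val_zero, Fin.val_one, h3]
      omega

/-! ### The shift of a valid representation as a function of its value -/

/-- The point `2 * φ - 3` is fixed by the map for the digit 1. A final 0 puts the error below this
point; a final 1, preceded by no 1 in a valid word, starts below it and is reflected above it, since
the slope `1 - φ` is negative. -/
theorem shiftError_of_valid {x : List (Fin 2)} (hx : Valid x) :
    (x.getLast? = some 1 → 2 * goldenRatio - 3 < shiftError digit x) ∧
      (x.getLast? ≠ some 1 → shiftError digit x < 2 * goldenRatio - 3) := by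
  obtain ⟨h1, h2⟩ := goldenRatio_bounds
  have hsq := goldenRatio_sq
  induction x using List.reverseRecOn with
  | nil =>
    simp only [shiftError, fibSum, Int.cast_zero]
    exact ⟨by simp, fun _ => by linarith⟩
  | append_singleton x a ih =>
    obtain ⟨hv, ha⟩ := valid_concat.mp hx
    obtain ⟨h3, h4⟩ := shiftError_digit_bounds x
    obtain ⟨-, h5⟩ := ih hv
    rw [shiftError_concat]
    rcases digit_eq a with ⟨rfl, h⟩ | ⟨rfl, h⟩ <;> rw [h] <;> push_cast
    · exact ⟨by simp, fun _ => by nlinarith⟩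
    · have h6 := h5 (ha rfl)
      exact ⟨fun _ => by nlinarith, by simp⟩

/-- The value of the representation of `Y` with the digit `0` appended. -/
noncomputable def shiftValue (Y : ℕ) : ℤ := ⌊goldenRatio * (Y + 1)⌋ - 1

/-- The bounds on the error say precisely that the shifted value plus one is the integral part of `φ
* (value x + 1)`. -/
theorem fibSum_shift_eq (x : List (Fin 2)) : fibSum 3 digit x = shiftValue (value x) := by
  obtain ⟨h1, h2⟩ := shiftError_digit_bounds x
  rw [shiftError, ← coe_value] at h1 h2
  push_cast at h1 h2
  rw [shiftValue, eq_sub_iff_add_eq, eq_comm, Int.floor_eq_iff]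
  push_cast
  constructor <;> linarith

/-- The shift increases by 2 or by 1 from `Y` to `Y + 1`, according to the side of `2 * φ - 3` on
which the error lies, and that is decided by the last digit. Hence last digits, too, can be read off
from increments of the shift. -/
theorem digit_getLast_eq {x : List (Fin 2)} (hx : Valid x) {a : Fin 2} (ha : x.getLast? = some a) :
    digit a = 2 + shiftValue (value x) - shiftValue (value x + 1) := by
  obtain ⟨h1, h2⟩ := shiftError_digit_bounds x
  obtain ⟨h3, h4⟩ := shiftError_of_valid hx
  obtain ⟨h5, h6⟩ := goldenRatio_bounds
  rw [shiftError, ← coe_value] at h1 h2 h3 h4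
  push_cast at h1 h2 h3 h4
  rw [← fibSum_shift_eq]
  have key : shiftValue (value x + 1) = fibSum 3 digit x + 2 - digit a := by
    rw [shiftValue, sub_eq_iff_eq_add, Int.floor_eq_iff]
    rcases digit_eq a with ⟨rfl, h⟩ | ⟨rfl, h⟩ <;> rw [h] <;> push_cast
    · have := h4 (by simp [ha])
      constructor <;> linarith
    · have := h3 ha
      constructor <;> linarith
  rw [key]
  ring

/-! ### Increments of the shift -/

/-- The increment of the shift from `Y` to `Y + i`, less the least possible value. -/
noncomputable def shiftIncr (Y i : ℕ) : ℤ :=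
  ⌊Int.fract (goldenRatio * (Y + 1)) + goldenRatio * i⌋ - ⌊goldenRatio * i⌋

theorem shiftValue_add (Y i : ℕ) :
    shiftValue (Y + i) = shiftValue Y + shiftIncr Y i + ⌊goldenRatio * i⌋ := by
  have h : goldenRatio * (((Y + i : ℕ) : ℝ) + 1) =
      Int.fract (goldenRatio * (Y + 1)) + goldenRatio * i + (⌊goldenRatio * (Y + 1)⌋ : ℤ) := by
    have := Int.fract_add_floor (goldenRatio * ((Y : ℝ) + 1))
    push_cast
    linarith
  rw [shiftValue, h, Int.floor_add_intCast, shiftValue, shiftIncr]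
  ring

theorem shiftIncr_nonneg (Y i : ℕ) : 0 ≤ shiftIncr Y i := by
  rw [shiftIncr, sub_nonneg]
  exact Int.floor_le_floor (le_add_of_nonneg_left (Int.fract_nonneg _))

theorem shiftIncr_le_one (Y i : ℕ) : shiftIncr Y i ≤ 1 := by
  rw [shiftIncr, sub_le_iff_le_add', ← Int.floor_add_one]
  refine Int.floor_le_floor ?_
  linarith [Int.fract_lt_one (goldenRatio * ((Y : ℝ) + 1))]

theorem shiftIncr_mono {Y Y' : ℕ}
    (h : Int.fract (goldenRatio * ((Y : ℝ) + 1)) ≤ Int.fract (goldenRatio * ((Y' : ℝ) + 1)))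
    (i : ℕ) : shiftIncr Y i ≤ shiftIncr Y' i :=
  Int.sub_le_sub_right (Int.floor_le_floor (by linarith)) _

/-- The sum of the first `n` increments. As the sequences of increments are totally ordered
componentwise, it determines all of them. -/
noncomputable def shiftIncrSum (n Y : ℕ) : ℤ := ∑ i ∈ Finset.range n, shiftIncr Y i

theorem shiftIncrSum_mem (n Y : ℕ) : shiftIncrSum n Y ∈ Finset.Icc (0 : ℤ) n := by
  rw [Finset.mem_Icc]
  refine ⟨Finset.sum_nonneg fun i _ => shiftIncr_nonneg Y i, ?_⟩
  refine (Finset.sum_le_card_nsmul _ _ 1 fun i _ => shiftIncr_le_one Y i).trans ?_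
  simp

theorem shiftIncr_eq_of_sum_eq {n Y Y' : ℕ} (h : shiftIncrSum n Y = shiftIncrSum n Y') {i : ℕ}
    (hi : i < n) : shiftIncr Y i = shiftIncr Y' i := by
  have key : ∀ Y Y' : ℕ, shiftIncrSum n Y = shiftIncrSum n Y' →
      Int.fract (goldenRatio * ((Y : ℝ) + 1)) ≤ Int.fract (goldenRatio * ((Y' : ℝ) + 1)) →
      shiftIncr Y i = shiftIncr Y' i := fun Y Y' h hle =>
    (Finset.sum_eq_sum_iff_of_le fun i _ => shiftIncr_mono hle i).mp h i (Finset.mem_range.mpr hi)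
  rcases le_total (Int.fract (goldenRatio * ((Y : ℝ) + 1)))
    (Int.fract (goldenRatio * ((Y' : ℝ) + 1))) with hle | hle
  · exact key Y Y' h hle
  · exact (key Y' Y h.symm hle).symm

/-! ### Bounded differences -/

theorem abs_fibSum_le_of_append {k : α → ℤ} {R : ℤ}
    (hR : ∀ w a, R < |fibSum 2 k w| → R < |fibSum 2 k (w ++ [a])|) (w v : List α)
    (h : |fibSum 2 k (w ++ v)| ≤ R) : |fibSum 2 k w| ≤ R := by
  induction v using List.reverseRecOn with
  | nil => simpa using h
  | append_singleton v a ih =>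
    refine ih ?_
    by_contra hlt
    rw [← List.append_assoc] at h
    exact absurd h (not_le.mpr (hR _ a (not_le.mp hlt)))

/-- A new letter replaces the sum `s` by `φ * s` up to an error of at most `2 * P`, and `(φ - 1) *
|s|` exceeds `2 * P` once `|s| > 4 * P`. -/
theorem lt_abs_fibSum_concat {k : α → ℤ} {P R : ℕ} (hk : ∀ a, |k a| ≤ P) (hR : 4 * P ≤ R)
    (w : List α) (a : α) (h : (R : ℤ) < |fibSum 2 k w|) :
    (R : ℤ) < |fibSum 2 k (w ++ [a])| := by
  obtain ⟨h1, h2⟩ := goldenRatio_bounds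
  have hka : |(k a : ℝ)| ≤ P := by exact_mod_cast hk a
  have h3 := abs_le.mp (abs_shiftError_le hk w)
  have h4 := abs_le.mp hka
  have hR' : (4 * P : ℝ) ≤ R := by exact_mod_cast hR
  have h5 : (R : ℝ) < |(fibSum 2 k w : ℝ)| := by exact_mod_cast h
  rw [fibSum_concat]
  suffices (R : ℝ) < |(fibSum 3 k w : ℝ) + k a| by exact_mod_cast this
  rw [shiftError] at h3
  rw [lt_abs] at h5 ⊢
  rcases h5 with h5 | h5
  · left
    nlinarith
  · right
    nlinarith

/-! ### Automata for linear relations -/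

/-- `A` recognizes the words whose consecutive letters are compatible and for which the sum with
the digits `k` is `c`; after each word for which a run exists the sum is at most `R` in absolute
value, and the state is determined by the sum, the shifted sum and the last letter. -/
structure Recognizes (A : PDFA α) (comp : α → α → Prop) (k : α → ℤ) (c : ℤ) (R : ℕ) : Prop where
  mem_language : ∀ w, w ∈ A.language ↔ w.IsChain comp ∧ fibSum 2 k w = c
  isChain : ∀ w q, A.runFrom A.start w = some q → w.IsChain comp
  abs_le : ∀ w q, A.runFrom A.start w = some q → |fibSum 2 k w| ≤ R
  congr : ∀ w w', w.IsChain comp → w'.IsChain comp → fibSum 2 k w = fibSum 2 k w' →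
    fibSum 3 k w = fibSum 3 k w' → w.getLast? = w'.getLast? →
    A.runFrom A.start w = A.runFrom A.start w'

theorem Recognizes.mono {A : PDFA α} {comp : α → α → Prop} {k : α → ℤ} {c : ℤ} {R R' : ℕ}
    (h : Recognizes A comp k c R) (hR : R ≤ R') : Recognizes A comp k c R' where
  mem_language := h.mem_language
  isChain := h.isChain
  abs_le w q hw := (h.abs_le w q hw).trans (by exact_mod_cast hR)
  congr := h.congr

/-- Every run of a minimal automaton extends to an accepted word, so a sum that can no longer return
to `c` has no run. Words with equal sums, shifted sums and last letters have the same accepted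
continuations, hence reach the same state. -/
theorem Recognizes.of_isMinimal {A : PDFA α} {comp : α → α → Prop} {k : α → ℤ} {c : ℤ}
    {P R : ℕ} (hA : A.IsMinimal)
    (hL : ∀ w, w ∈ A.language ↔ w.IsChain comp ∧ fibSum 2 k w = c)
    (hk : ∀ a, |k a| ≤ P) (hR : 4 * P ≤ R) (hc : |c| ≤ R) : Recognizes A comp k c R := by
  have hext : ∀ w q, A.runFrom A.start w = some q → ∃ v, w ++ v ∈ A.language := by
    intro w q hw
    obtain ⟨v, hv⟩ := (hA.1 q).2
    exact ⟨v, (acceptsFrom_of_runFrom hw v).mp hv⟩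
  have key : ∀ w w', w.IsChain comp → w'.IsChain comp → fibSum 2 k w = fibSum 2 k w' →
      fibSum 3 k w = fibSum 3 k w' → w.getLast? = w'.getLast? → ∀ q,
      A.runFrom A.start w = some q → A.runFrom A.start w' = some q := by
    intro w w' h1 h1' h2 h3 h4 q hq
    have hiff : ∀ v, w ++ v ∈ A.language ↔ w' ++ v ∈ A.language := by
      intro v
      rw [hL, hL, fibSum_append_congr h2 h3, List.isChain_append, List.isChain_append, h4]
      simp only [h1, h1', true_and]
    obtain ⟨v, hv⟩ := hext w q hq
    obtain ⟨q', hq', -⟩ := exists_runFrom_of_acceptsFrom_append ((hiff v).mp hv)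
    have hqq : q = q' := hA.2 q q' fun u =>
      (acceptsFrom_of_runFrom hq u).trans ((hiff u).trans (acceptsFrom_of_runFrom hq' u).symm)
    rw [hqq, hq']
  refine ⟨hL, fun w q hw => ?_, fun w q hw => ?_, fun w w' h1 h1' h2 h3 h4 => ?_⟩
  · obtain ⟨v, hv⟩ := hext w q hw
    exact ((hL _).mp hv).1.left_of_append
  · obtain ⟨v, hv⟩ := hext w q hw
    refine abs_fibSum_le_of_append (fun u a hu => lt_abs_fibSum_concat hk hR u a hu) w v ?_
    rw [((hL _).mp hv).2]
    exact hc
  · exact Option.ext fun q => ⟨key w w' h1 h1' h2 h3 h4 q,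
      key w' w h1' h1 h2.symm h3.symm h4.symm q⟩

/-- Two consecutive letters of a valid word. -/
def DigitCompat (a b : Fin 2) : Prop := ¬ (a = 1 ∧ b = 1)

/-- Two consecutive letters of a word all of whose two tracks are valid. -/
def PairCompat (a b : Fin 2 × Fin 2) : Prop := DigitCompat a.1 b.1 ∧ DigitCompat a.2 b.2

/-- Two consecutive letters of a word all of whose three tracks are valid. -/
def TripleCompat (a b : Fin 2 × Fin 2 × Fin 2) : Prop :=
  DigitCompat a.1 b.1 ∧ DigitCompat a.2.1 b.2.1 ∧ DigitCompat a.2.2 b.2.2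

theorem isChain_and {r s : α → α → Prop} {w : List α} :
    w.IsChain (fun a b => r a b ∧ s a b) ↔ w.IsChain r ∧ w.IsChain s := by
  induction w with
  | nil => simp
  | cons a w ih =>
    simp only [List.isChain_cons, ih]
    constructor
    · exact fun ⟨h, h1, h2⟩ => ⟨⟨fun y hy => (h y hy).1, h1⟩, ⟨fun y hy => (h y hy).2, h2⟩⟩
    · exact fun ⟨⟨h1, h2⟩, ⟨h3, h4⟩⟩ => ⟨fun y hy => ⟨h1 y hy, h3 y hy⟩, h2, h4⟩

theorem isChain_concat {r : α → α → Prop} {w : List α} {a : α} :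
    (w ++ [a]).IsChain r ↔ w.IsChain r ∧ ∀ b ∈ w.getLast?, r b a := by
  simp [List.isChain_append]

theorem isChain_pairCompat {w : List (Fin 2 × Fin 2)} :
    w.IsChain PairCompat ↔ Valid (w.map Prod.fst) ∧ Valid (w.map Prod.snd) := by
  rw [Valid, Valid, List.isChain_map, List.isChain_map, ← isChain_and]
  rfl

/-! ### The basic automata -/

theorem runFrom_zeroAut {w : List (Fin 2)} {q : zeroAut.State} :
    zeroAut.runFrom zeroAut.start w = some q ↔ fibSum 2 digit w = 0 := by
  induction w using List.reverseRecOn with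
  | nil => exact ⟨fun _ => rfl, fun _ => rfl⟩
  | append_singleton w a ih =>
    rw [runFrom_concat, fibSum_concat, Option.bind_eq_some_iff]
    have hrun : (∃ p, zeroAut.runFrom zeroAut.start w = some p ∧ zeroAut.step p a = some q) ↔
        fibSum 2 digit w = 0 ∧ a = 0 := by
      constructor
      · rintro ⟨p, h1, h2⟩
        refine ⟨ih.mp h1, ?_⟩
        by_contra h
        simp [zeroAut, h] at h2
      · rintro ⟨h1, rfl⟩
        exact ⟨q, ih.mpr h1, rfl⟩
    rw [hrun]
    have h0 := fibSum_digit w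
    rcases digit_eq a with ⟨rfl, h⟩ | ⟨rfl, h⟩ <;> rw [h] <;> simp <;> omega

theorem getLast_eq_zero {w : List (Fin 2)} (h : fibSum 2 digit w = 0) :
    ∀ b ∈ w.getLast?, b = 0 := by
  induction w using List.reverseRecOn with
  | nil => simp
  | append_singleton w a _ =>
    rw [fibSum_concat] at h
    have h0 := fibSum_digit w
    simp only [List.getLast?_concat, Option.mem_def, Option.some.injEq, forall_eq']
    rcases digit_eq a with ⟨rfl, h'⟩ | ⟨rfl, h'⟩
    · rfl
    · omega

theorem isChain_of_fibSum_le_one {w : List (Fin 2)} (h : fibSum 2 digit w ≤ 1) :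
    w.IsChain DigitCompat := by
  induction w using List.reverseRecOn with
  | nil => simp
  | append_singleton w a ih =>
    rw [fibSum_concat] at h
    have h0 := fibSum_digit w
    have hw : fibSum 2 digit w = 0 := by
      rcases digit_eq a with ⟨-, h'⟩ | ⟨-, h'⟩ <;> omega
    refine isChain_concat.mpr ⟨ih (by omega), fun b hb => ?_⟩
    rw [getLast_eq_zero hw b hb]
    simp [DigitCompat]

theorem recognizes_zeroAut : Recognizes zeroAut DigitCompat digit 0 4 where
  mem_language w := by
    constructor
    · rintro ⟨q, -, hq⟩
      have h := runFrom_zeroAut.mp hq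
      exact ⟨isChain_of_fibSum_le_one (by omega), h⟩
    · rintro ⟨-, h⟩
      exact ⟨(), trivial, runFrom_zeroAut.mpr h⟩
  isChain w q hq := isChain_of_fibSum_le_one (by have := runFrom_zeroAut.mp hq; omega)
  abs_le w q hq := by simp [runFrom_zeroAut.mp hq]
  congr w w' _ _ h _ _ := Option.ext fun q => by rw [runFrom_zeroAut, runFrom_zeroAut, h]

theorem runFrom_oneAut {w : List (Fin 2)} {q : Fin 2} :
    oneAut.runFrom oneAut.start w = some q ↔ fibSum 2 digit w = digit q := by
  induction w using List.reverseRecOn generalizing q with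
  | nil =>
    rcases digit_eq q with ⟨rfl, h⟩ | ⟨rfl, h⟩ <;> rw [h] <;> simp [runFrom, fibSum, oneAut]
  | append_singleton w a ih =>
    rw [runFrom_concat, fibSum_concat]
    refine Option.bind_eq_some_iff.trans ?_
    have hrun : (∃ p, oneAut.runFrom oneAut.start w = some p ∧ oneAut.step p a = some q) ↔
        fibSum 2 digit w = 0 ∧ a = q := by
      constructor
      · rintro ⟨p, h1, h2⟩
        by_cases hp : p = (0 : Fin 2)
        · subst hp
          exact ⟨ih.mp h1, by simpa [oneAut] using h2⟩
        · have hnone : oneAut.step p a = none := if_neg hp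
          simp [hnone] at h2
      · rintro ⟨h1, rfl⟩
        exact ⟨(0 : Fin 2), ih.mpr h1, by simp [oneAut]⟩
    refine hrun.trans ?_
    have h0 := fibSum_digit w
    rcases digit_eq a with ⟨rfl, h⟩ | ⟨rfl, h⟩ <;> rcases digit_eq q with ⟨rfl, h'⟩ | ⟨rfl, h'⟩ <;>
      simp only [h, h'] <;> simp <;> omega

theorem recognizes_oneAut : Recognizes oneAut DigitCompat digit 1 4 where
  mem_language w := by
    constructor
    · rintro ⟨q, hq1, hq⟩
      have hq1' : q = (1 : Fin 2) := hq1
      subst hq1'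
      have h : fibSum 2 digit w = 1 := runFrom_oneAut.mp hq
      exact ⟨isChain_of_fibSum_le_one (by omega), h⟩
    · rintro ⟨-, h⟩
      exact ⟨(1 : Fin 2), rfl, runFrom_oneAut.mpr h⟩
  isChain w q hq := isChain_of_fibSum_le_one (by
    rw [runFrom_oneAut.mp hq]
    rcases digit_eq q with ⟨-, h⟩ | ⟨-, h⟩ <;> simp [h])
  abs_le w q hq := by
    rw [runFrom_oneAut.mp hq]
    rcases digit_eq q with ⟨-, h⟩ | ⟨-, h⟩ <;> rw [h] <;> simp
  congr w w' _ _ h _ _ := Option.ext fun q => by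
    refine (runFrom_oneAut (q := q)).trans (Iff.trans ?_ (runFrom_oneAut (q := q)).symm)
    rw [h]

/-- The digits of the relation `n[x] - [z]`. -/
def mulDigit (n : ℕ) (l : Fin 2 × Fin 2) : ℤ := n * digit l.1 - digit l.2

theorem fibSum_mulDigit (j n : ℕ) (w : List (Fin 2 × Fin 2)) :
    fibSum j (mulDigit n) w =
      n * fibSum j digit (w.map Prod.fst) - fibSum j digit (w.map Prod.snd) := by
  rw [fibSum_map, fibSum_map, fibSum_linear (p := n) (q := -1)
    (k₁ := fun l : Fin 2 × Fin 2 => digit l.1) (k₂ := fun l => digit l.2)]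
  · ring
  · intro l
    rw [mulDigit]
    ring

theorem runFrom_eqAut {w : List (Fin 2 × Fin 2)} {q : Fin 2} :
    eqAut.runFrom eqAut.start w = some q ↔
      w.IsChain PairCompat ∧ w.map Prod.fst = w.map Prod.snd ∧
        (w.getLast?.map Prod.fst).getD 0 = q := by
  induction w using List.reverseRecOn generalizing q with
  | nil => simp [runFrom, eqAut]
  | append_singleton w l ih =>
    obtain ⟨a, b⟩ := l
    rw [runFrom_concat, isChain_concat]
    refine Option.bind_eq_some_iff.trans ?_
    constructor
    · rintro ⟨p, h1, h2⟩
      obtain ⟨h3, h4, rfl⟩ := ih.mp h1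
      simp only [eqAut] at h2
      split at h2
      · rename_i h
        obtain ⟨rfl, h⟩ := h
        refine ⟨⟨h3, ?_⟩, by simp [h4], by simpa using h2⟩
        intro c hc
        have hcc : c.1 = c.2 := by
          have h5 : (w.map Prod.fst).getLast? = (w.map Prod.snd).getLast? := by rw [h4]
          rw [List.getLast?_map, List.getLast?_map, Option.mem_def.mp hc] at h5
          simpa using h5
        rw [Option.mem_def.mp hc] at h
        simpa [PairCompat, DigitCompat, ← hcc] using h
      · simp at h2
    · rintro ⟨⟨h3, h5⟩, h4, h6⟩
      simp only [List.map_append, List.map_cons, List.map_nil, List.append_singleton_inj] at h4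
      obtain ⟨h4, rfl⟩ := h4
      refine ⟨_, ih.mpr ⟨h3, h4, rfl⟩, ?_⟩
      have h6' : a = q := by simpa using h6
      subst h6'
      simp only [eqAut]
      rw [if_pos]
      refine ⟨trivial, ?_⟩
      cases hl : w.getLast? with
      | none => simp
      | some c => exact (h5 c hl).1

theorem map_fst_eq_map_snd_iff {w : List (Fin 2 × Fin 2)} (hw : w.IsChain PairCompat) :
    w.map Prod.fst = w.map Prod.snd ↔ fibSum 2 (mulDigit 1) w = 0 := by
  rw [fibSum_mulDigit]
  obtain ⟨h1, h2⟩ := isChain_pairCompat.mp hw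
  constructor
  · intro h
    rw [h]
    simp
  · intro h
    refine h1.eq_of_value_eq h2 (by simp) ?_
    have : (value (w.map Prod.fst) : ℤ) = value (w.map Prod.snd) := by
      rw [coe_value, coe_value]
      push_cast at h
      linarith
    exact_mod_cast this

theorem recognizes_eqAut : Recognizes eqAut PairCompat (mulDigit 1) 0 4 where
  mem_language w := by
    constructor
    · rintro ⟨q, -, hq⟩
      obtain ⟨h1, h2, -⟩ := runFrom_eqAut.mp hq
      exact ⟨h1, (map_fst_eq_map_snd_iff h1).mp h2⟩
    · rintro ⟨h1, h2⟩
      exact ⟨_, trivial, runFrom_eqAut.mpr ⟨h1, (map_fst_eq_map_snd_iff h1).mpr h2, rfl⟩⟩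
  isChain w q hq := (runFrom_eqAut.mp hq).1
  abs_le w q hq := by
    obtain ⟨h1, h2, -⟩ := runFrom_eqAut.mp hq
    simp [(map_fst_eq_map_snd_iff h1).mp h2]
  congr w w' h1 h1' h2 _ h4 := Option.ext fun q => by
    refine (runFrom_eqAut (q := q)).trans (Iff.trans ?_ (runFrom_eqAut (q := q)).symm)
    rw [map_fst_eq_map_snd_iff h1, map_fst_eq_map_snd_iff h1', h2, h4]
    simp only [h1, h1']

theorem digitDiff_eq (l : Fin 2 × Fin 2 × Fin 2) :
    digitDiff l = digit l.1 + digit l.2.1 - digit l.2.2 := rfl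

theorem fibSum_digitDiff (j : ℕ) (w : List (Fin 2 × Fin 2 × Fin 2)) :
    fibSum j digitDiff w = fibSum j digit (w.map fun l => l.1) +
      fibSum j digit (w.map fun l => l.2.1) - fibSum j digit (w.map fun l => l.2.2) := by
  rw [fibSum_map, fibSum_map, fibSum_map]
  induction w with
  | nil => rfl
  | cons l w ih =>
    simp only [fibSum, ih, digitDiff_eq]
    ring

theorem digitDiff_bounds (l : Fin 2 × Fin 2 × Fin 2) : -1 ≤ digitDiff l ∧ digitDiff l ≤ 2 := by
  rw [digitDiff_eq]
  rcases digit_eq l.1 with ⟨-, h1⟩ | ⟨-, h1⟩ <;> rcases digit_eq l.2.1 with ⟨-, h2⟩ | ⟨-, h2⟩ <;>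
    rcases digit_eq l.2.2 with ⟨-, h3⟩ | ⟨-, h3⟩ <;> rw [h1, h2, h3] <;> omega

/-- The general escape bound would need a radius larger than 4. The sharper error intervals of the
three binary tracks put the total error between `φ - 3` and `φ`, which suffices from `±5` on. -/
theorem four_lt_abs_fibSum_concat (w : List (Fin 2 × Fin 2 × Fin 2)) (l : Fin 2 × Fin 2 × Fin 2)
    (h : 4 < |fibSum 2 digitDiff w|) : 4 < |fibSum 2 digitDiff (w ++ [l])| := by
  obtain ⟨h1, h2⟩ := goldenRatio_bounds
  obtain ⟨h3, h4⟩ := shiftError_digit_bounds (w.map fun l => l.1)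
  obtain ⟨h5, h6⟩ := shiftError_digit_bounds (w.map fun l => l.2.1)
  obtain ⟨h7, h8⟩ := shiftError_digit_bounds (w.map fun l => l.2.2)
  obtain ⟨h9, h10⟩ := digitDiff_bounds l
  have h9' : (-1 : ℝ) ≤ digitDiff l := by exact_mod_cast h9
  have h10' : (digitDiff l : ℝ) ≤ 2 := by exact_mod_cast h10
  have herr : (fibSum 3 digitDiff w : ℝ) = goldenRatio * fibSum 2 digitDiff w +
      (shiftError digit (w.map fun l => l.1) + shiftError digit (w.map fun l => l.2.1) -
        shiftError digit (w.map fun l => l.2.2)) := by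
    rw [fibSum_digitDiff, fibSum_digitDiff]
    simp only [shiftError]
    push_cast
    ring
  rw [fibSum_concat, lt_abs]
  rcases lt_abs.mp h with h | h
  · left
    have h' : (5 : ℝ) ≤ fibSum 2 digitDiff w := by exact_mod_cast h
    suffices (4 : ℝ) < fibSum 3 digitDiff w + digitDiff l by exact_mod_cast this
    nlinarith
  · right
    have h' : (fibSum 2 digitDiff w : ℝ) ≤ -5 := by
      have : fibSum 2 digitDiff w ≤ -5 := by omega
      exact_mod_cast this
    have h'' : ((fibSum 3 digitDiff w + digitDiff l : ℤ) : ℝ) < ((-4 : ℤ) : ℝ) := by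
      push_cast
      nlinarith
    have := Int.cast_lt.mp h''
    omega

/-- The expression is the sum before the last letter, which cannot have left the range if the
present sum is in it. For the empty word the default letter contributes 0. -/
theorem abs_fibSum_dropLast_le {w : List (Fin 2 × Fin 2 × Fin 2)}
    (h : |fibSum 2 digitDiff w| ≤ 4) :
    |fibSum 3 digitDiff w - fibSum 2 digitDiff w - digitDiff (w.getLast?.getD (0, 0, 0))| ≤ 4 := by
  induction w using List.reverseRecOn with
  | nil => simp [fibSum, digitDiff]
  | append_singleton w l _ =>
    have hw : |fibSum 2 digitDiff w| ≤ 4 := abs_fibSum_le_of_append four_lt_abs_fibSum_concat w [l] h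
    rw [fibSum_concat, fibSum_shift_concat]
    simp only [List.getLast?_concat, Option.getD_some]
    convert hw using 2
    ring

theorem runFrom_addAut {w : List (Fin 2 × Fin 2 × Fin 2)} {q : addAut.State} :
    addAut.runFrom addAut.start w = some q ↔
      w.IsChain TripleCompat ∧ |fibSum 2 digitDiff w| ≤ 4 ∧ w.getLast?.getD (0, 0, 0) = q.1 ∧
        q.2.1.1 = fibSum 2 digitDiff w ∧
        q.2.2.1 = fibSum 3 digitDiff w - fibSum 2 digitDiff w - digitDiff q.1 := by
  induction w using List.reverseRecOn generalizing q with
  | nil =>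
    obtain ⟨l, ⟨d, hd⟩, ⟨e, he⟩⟩ := q
    have : addAut.runFrom addAut.start [] = some (l, ⟨d, hd⟩, ⟨e, he⟩) ↔
        (0, 0, 0) = l ∧ 0 = d ∧ 0 = e := by
      simp [runFrom, addAut, Prod.ext_iff, Subtype.ext_iff]
    refine this.trans ?_
    simp only [List.isChain_nil, fibSum, abs_zero, List.getLast?_nil, Option.getD_none, true_and,
      sub_zero, zero_sub, Nat.ofNat_nonneg]
    constructor
    · rintro ⟨rfl, rfl, rfl⟩
      exact ⟨rfl, rfl, rfl⟩
    · rintro ⟨rfl, h1, h2⟩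
      exact ⟨rfl, h1.symm, h2.symm⟩
  | append_singleton w l ih =>
    rw [runFrom_concat, Option.bind_eq_some_iff, isChain_concat, fibSum_concat,
      fibSum_shift_concat]
    have hcompat : ∀ b : Fin 2 × Fin 2 × Fin 2, w.getLast?.getD (0, 0, 0) = b →
        ((∀ a ∈ w.getLast?, TripleCompat a l) ↔ TripleCompat b l) := by
      rintro b rfl
      cases w.getLast? with
      | none => simp [TripleCompat, DigitCompat]
      | some c => simp
    constructor
    · rintro ⟨p, h1, h2⟩
      obtain ⟨h3, h4, h5, h6, h7⟩ := ih.mp h1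
      simp only [addAut] at h2
      split at h2
      · rename_i h
        have h2' := Option.some.inj h2
        subst h2'
        have hsum : p.2.1.1 + p.2.2.1 + digitDiff p.1 + digitDiff l =
            fibSum 3 digitDiff w + digitDiff l := by
          rw [h6, h7]
          ring
        refine ⟨⟨h3, (hcompat _ h5).mpr h.1⟩, ?_, by simp, hsum, ?_⟩
        · rw [← hsum, abs_le]
          exact h.2
        · simp only [h6]
          ring
      · simp at h2
    · rintro ⟨⟨h3, h8⟩, h4, h5, h6, h7⟩
      have h9 : |fibSum 2 digitDiff w| ≤ 4 := by
        by_contra hlt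
        have := four_lt_abs_fibSum_concat w l (not_le.mp hlt)
        rw [fibSum_concat] at this
        omega
      have hq : q.2.2.1 = fibSum 2 digitDiff w := by
        rw [h7, ← h5]
        simp only [List.getLast?_concat, Option.getD_some]
        ring
      have hprev := abs_fibSum_dropLast_le h9
      refine ⟨(w.getLast?.getD (0, 0, 0), ⟨_, abs_le.mp h9⟩, ⟨_, abs_le.mp hprev⟩),
        ih.mpr ⟨h3, h9, rfl, rfl, rfl⟩, ?_⟩
      have hsum : fibSum 2 digitDiff w + (fibSum 3 digitDiff w - fibSum 2 digitDiff w -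
          digitDiff (w.getLast?.getD (0, 0, 0))) + digitDiff (w.getLast?.getD (0, 0, 0)) +
          digitDiff l = fibSum 3 digitDiff w + digitDiff l := by ring
      have hl : l = q.1 := by simpa using h5
      simp only [addAut]
      rw [dif_pos ⟨(hcompat _ rfl).mp h8, by rw [hsum]; exact abs_le.mp h4⟩]
      refine congrArg some (Prod.ext hl (Prod.ext (Subtype.ext ?_) (Subtype.ext ?_)))
      · exact hsum.trans h6.symm
      · exact hq.symm

theorem exists_runFrom_addAut {w : List (Fin 2 × Fin 2 × Fin 2)} (h1 : w.IsChain TripleCompat)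
    (h2 : |fibSum 2 digitDiff w| ≤ 4) : ∃ q, addAut.runFrom addAut.start w = some q :=
  ⟨(w.getLast?.getD (0, 0, 0), ⟨_, abs_le.mp h2⟩, ⟨_, abs_le.mp (abs_fibSum_dropLast_le h2)⟩),
    runFrom_addAut.mpr ⟨h1, h2, rfl, rfl, rfl⟩⟩

theorem recognizes_addAut : Recognizes addAut TripleCompat digitDiff 0 4 where
  mem_language w := by
    constructor
    · rintro ⟨q, hacc, hq⟩
      obtain ⟨h1, -, -, h2, -⟩ := runFrom_addAut.mp hq
      have hacc' : q.2.1.1 = 0 := hacc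
      exact ⟨h1, by rw [← h2, hacc']⟩
    · rintro ⟨h1, h2⟩
      obtain ⟨q, hq⟩ := exists_runFrom_addAut h1 (by simp [h2])
      exact ⟨q, (runFrom_addAut.mp hq).2.2.2.1.trans h2, hq⟩
  isChain w q hq := (runFrom_addAut.mp hq).1
  abs_le w q hq := (runFrom_addAut.mp hq).2.1
  congr w w' h1 h1' h2 h3 h4 := Option.ext fun q => by
    rw [runFrom_addAut, runFrom_addAut, h2, h3, h4]
    simp only [h1, h1']

/-! ### Elimination of a track -/

/-- Letters over `γ` consist of a visible letter `h` and a digit `y` of the track to be eliminated;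
the digits of two linear relations and the compatibility of letters are expressed by these. -/
structure Elimination (f : γ → α) (g : γ → β) (h : γ → δ) (y : γ → Fin 2)
    (compA : α → α → Prop) (compB : β → β → Prop) (compD : δ → δ → Prop)
    (kA : α → ℤ) (kB : β → ℤ) (a b : δ → ℤ) (pA pB : ℤ) : Prop where
  exists_letter : ∀ d e, ∃ l, h l = d ∧ y l = e
  letter_ext : ∀ l l', h l = h l' → y l = y l' → l = l'
  compat : ∀ l l', compA (f l) (f l') ∧ compB (g l) (g l') ↔
    compD (h l) (h l') ∧ DigitCompat (y l) (y l')
  left_eq : ∀ l, kA (f l) = a (h l) + pA * digit (y l)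
  right_eq : ∀ l, kB (g l) = b (h l) + pB * digit (y l)
  left_ne : pA ≠ 0

namespace Elimination

variable {f : γ → α} {g : γ → β} {h : γ → δ} {y : γ → Fin 2}
  {compA : α → α → Prop} {compB : β → β → Prop} {compD : δ → δ → Prop}
  {kA : α → ℤ} {kB : β → ℤ} {a b : δ → ℤ} {pA pB : ℤ}

theorem exists_word (H : Elimination f g h y compA compB compD kA kB a b pA pB) (w : List δ)
    (u : List (Fin 2)) (hlen : u.length = w.length) : ∃ v : List γ, v.map h = w ∧ v.map y = u := by
  induction w generalizing u with
  | nil => exact ⟨[], rfl, (List.length_eq_zero_iff.mp hlen).symm⟩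
  | cons d w ih =>
    obtain _ | ⟨e, u⟩ := u
    · simp at hlen
    · obtain ⟨v, h1, h2⟩ := ih u (by simpa using hlen)
      obtain ⟨l, h3, h4⟩ := H.exists_letter d e
      exact ⟨l :: v, by simp [h1, h3], by simp [h2, h4]⟩

theorem word_ext (H : Elimination f g h y compA compB compD kA kB a b pA pB) {v v' : List γ}
    (h1 : v.map h = v'.map h) (h2 : v.map y = v'.map y) : v = v' := by
  induction v generalizing v' with
  | nil => simpa using h1.symm
  | cons l v ih =>
    obtain _ | ⟨l', v'⟩ := v'
    · simp at h1
    · simp only [List.map_cons, List.cons.injEq] at h1 h2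
      rw [H.letter_ext l l' h1.1 h2.1, ih h1.2 h2.2]

theorem isChain_iff (H : Elimination f g h y compA compB compD kA kB a b pA pB) (v : List γ) :
    (v.map f).IsChain compA ∧ (v.map g).IsChain compB ↔
      (v.map h).IsChain compD ∧ Valid (v.map y) := by
  rw [show Valid (v.map y) ↔ (v.map y).IsChain DigitCompat from Iff.rfl, List.isChain_map,
    List.isChain_map, List.isChain_map, List.isChain_map, ← isChain_and, ← isChain_and]
  simp only [H.compat]

theorem fibSum_left (H : Elimination f g h y compA compB compD kA kB a b pA pB) (j : ℕ)
    (v : List γ) :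
    fibSum j kA (v.map f) = fibSum j a (v.map h) + pA * fibSum j digit (v.map y) := by
  rw [fibSum_map, fibSum_map, fibSum_map, fibSum_linear (p := 1) (q := pA), one_mul]
  intro l
  rw [H.left_eq, one_mul]

theorem fibSum_right (H : Elimination f g h y compA compB compD kA kB a b pA pB) (j : ℕ)
    (v : List γ) :
    fibSum j kB (v.map g) = fibSum j b (v.map h) + pB * fibSum j digit (v.map y) := by
  rw [fibSum_map, fibSum_map, fibSum_map, fibSum_linear (p := 1) (q := pB), one_mul]
  intro l
  rw [H.right_eq, one_mul]

/-- The bound on `Y` matters: projection does not add leading zeros, so the eliminated number must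
be representable in the length of the visible word. In all applications it is at most the value of a
visible track. -/
theorem spec (H : Elimination f g h y compA compB compD kA kB a b pA pB)
    {A : PDFA α} {B : PDFA β} {cA cB : ℤ} {R : ℕ} (hA : Recognizes A compA kA cA R)
    (hB : Recognizes B compB kB cB R) {M : PDFA δ} {t : ℕ} (hM : Combine A f B g h M t)
    {k : δ → ℤ} {c : ℤ} (hne : ∃ w : List δ, w.IsChain compD ∧ fibSum 2 k w = c)
    (hiff : ∀ w : List δ, w.IsChain compD →
      (fibSum 2 k w = c ↔ ∃ Y : ℕ, Y < Nat.fib (w.length + 2) ∧ fibSum 2 a w + pA * Y = cA ∧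
        fibSum 2 b w + pB * Y = cB)) :
    M.IsMinimal ∧ ∀ w, w ∈ M.language ↔ w.IsChain compD ∧ fibSum 2 k w = c := by
  have h1 := hM.spec (L := {w | w.IsChain compD ∧ fibSum 2 k w = c}) hne fun w => by
    constructor
    · rintro ⟨hw, hc⟩
      obtain ⟨Y, hY, h2, h3⟩ := (hiff w hw).mp hc
      obtain ⟨u, hu, hval, rfl⟩ := exists_valid_value_eq _ hY
      obtain ⟨v, rfl, rfl⟩ := H.exists_word w u hu
      have hch := (H.isChain_iff v).mpr ⟨hw, hval⟩
      rw [coe_value] at h2 h3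
      refine ⟨v, rfl, (hA.mem_language _).mpr ⟨hch.1, ?_⟩, (hB.mem_language _).mpr ⟨hch.2, ?_⟩⟩
      · rw [H.fibSum_left, h2]
      · rw [H.fibSum_right, h3]
    · rintro ⟨v, rfl, hvA, hvB⟩
      obtain ⟨h2, h3⟩ := (hA.mem_language _).mp hvA
      obtain ⟨h4, h5⟩ := (hB.mem_language _).mp hvB
      obtain ⟨h6, h7⟩ := (H.isChain_iff v).mp ⟨h2, h4⟩
      refine ⟨h6, (hiff _ h6).mpr ⟨value (v.map y), ?_, ?_, ?_⟩⟩
      · simpa using value_lt h7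
      · rw [coe_value, ← H.fibSum_left, h3]
      · rw [coe_value, ← H.fibSum_right, h5]
  exact ⟨h1.1, fun w => by rw [h1.2]; rfl⟩

end Elimination

/-! ### The number of states and subsets -/

section Count

variable {f : γ → α} {g : γ → β} {h : γ → δ} {y : γ → Fin 2}
  {compA : α → α → Prop} {compB : β → β → Prop} {compD : δ → δ → Prop}
  {kA : α → ℤ} {kB : β → ℤ} {a b : δ → ℤ} {pA pB : ℤ} {A : PDFA α} {B : PDFA β} {cA cB : ℤ} {R : ℕ}

/-- The run of the product automaton on a word. -/
def ProductRun (A : PDFA α) (f : γ → α) (B : PDFA β) (g : γ → β) (v : List γ)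
    (q : A.State × B.State) : Prop :=
  A.runFrom A.start (v.map f) = some q.1 ∧ B.runFrom B.start (v.map g) = some q.2

/-- The pair of states that a state of the product automaton stands for. -/
def pairOf (q : (product A f B g).State) : A.State × B.State := q.1

theorem pairOf_injective : Function.Injective (pairOf (A := A) (f := f) (B := B) (g := g)) :=
  Subtype.val_injective

theorem card_le_card_of_injective {σ κ : Type} (F : σ → κ) (hF : Function.Injective F)
    (T : Finset κ) (hT : ∀ x, F x ∈ T) : Nat.card σ ≤ T.card := by
  rw [← Fintype.card_coe, ← Nat.card_eq_fintype_card]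
  exact Nat.card_le_card_of_injective (fun x => (⟨F x, hT x⟩ : T)) fun x x' h =>
    hF (congrArg Subtype.val h)

theorem ProductRun.unique {v : List γ} {q q' : A.State × B.State} (h1 : ProductRun A f B g v q)
    (h2 : ProductRun A f B g v q') : q = q' :=
  Prod.ext (Option.some.inj (h1.1.symm.trans h2.1)) (Option.some.inj (h1.2.symm.trans h2.2))

theorem ProductRun.isChain (H : Elimination f g h y compA compB compD kA kB a b pA pB)
    (hA : Recognizes A compA kA cA R) (hB : Recognizes B compB kB cB R) {v : List γ}
    {q : A.State × B.State} (hq : ProductRun A f B g v q) :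
    (v.map h).IsChain compD ∧ Valid (v.map y) :=
  (H.isChain_iff v).mp ⟨hA.isChain _ _ hq.1, hB.isChain _ _ hq.2⟩

/-- The excess of the shifted sum over the integral part of `φ` times the sum. -/
noncomputable def shiftExcess (k : α → ℤ) (w : List α) : ℤ :=
  fibSum 3 k w - ⌊goldenRatio * fibSum 2 k w⌋

/-- Given the sum, this leaves at most `2 * P + 1` possibilities for the shifted sum. -/
theorem shiftExcess_mem {k : α → ℤ} {P : ℕ} (hk : ∀ l, |k l| ≤ P) (w : List α) :
    shiftExcess k w ∈ Finset.Icc (-(P : ℤ)) P := by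
  have h1 := abs_le.mp (abs_shiftError_le hk w)
  rw [shiftError] at h1
  have h2 := Int.floor_le (goldenRatio * fibSum 2 k w)
  have h3 := Int.lt_floor_add_one (goldenRatio * fibSum 2 k w)
  rw [Finset.mem_Icc, shiftExcess]
  constructor
  · have : ((-(P : ℤ) : ℤ) : ℝ) ≤ ((fibSum 3 k w - ⌊goldenRatio * fibSum 2 k w⌋ : ℤ) : ℝ) := by
      push_cast
      linarith
    exact_mod_cast this
  · have : ((fibSum 3 k w - ⌊goldenRatio * fibSum 2 k w⌋ : ℤ) : ℝ) < ((P + 1 : ℤ) : ℝ) := by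
      push_cast
      linarith
    have := Int.cast_lt.mp this
    omega

/-- The data of a word that determine its run in the product automaton. -/
noncomputable def runKey (f : γ → α) (g : γ → β) (kA : α → ℤ) (kB : β → ℤ) (v : List γ) :
    ℤ × ℤ × ℤ × ℤ × Option γ :=
  (fibSum 2 kA (v.map f), shiftExcess kA (v.map f), fibSum 2 kB (v.map g),
    shiftExcess kB (v.map g), v.getLast?)

/-- The possible values of `runKey`. -/
noncomputable def runKeys (γ : Type) [Fintype γ] (R : ℕ) : Finset (ℤ × ℤ × ℤ × ℤ × Option γ) :=
  Finset.Icc (-(R : ℤ)) R ×ˢ Finset.Icc (-(R : ℤ)) R ×ˢ Finset.Icc (-(R : ℤ)) R ×ˢ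
    Finset.Icc (-(3 : ℕ) : ℤ) (3 : ℕ) ×ˢ Finset.univ

theorem card_runKeys [Fintype γ] (hγ : Fintype.card γ ≤ 8) (R : ℕ) :
    (runKeys γ R).card ≤ (2 * R + 1) ^ 3 * 63 := by
  have h1 : (Finset.Icc (-(R : ℤ)) R).card = 2 * R + 1 := by
    rw [Int.card_Icc]
    omega
  have h2 : (Finset.Icc (-(3 : ℕ) : ℤ) (3 : ℕ)).card = 7 := rfl
  rw [runKeys, Finset.card_product, Finset.card_product, Finset.card_product, Finset.card_product,
    h1, h2, Finset.card_univ, Fintype.card_option]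
  calc _ ≤ (2 * R + 1) * ((2 * R + 1) * ((2 * R + 1) * (7 * (8 + 1)))) := by gcongr
    _ = _ := by ring

theorem ProductRun.runKey_mem [Fintype γ] (hA : Recognizes A compA kA cA R)
    (hB : Recognizes B compB kB cB R) (hkA : ∀ l, |kA l| ≤ R) (hkB : ∀ l, |kB l| ≤ 3)
    {v : List γ} {q : A.State × B.State} (hq : ProductRun A f B g v q) :
    runKey f g kA kB v ∈ runKeys γ R := by
  simp only [runKey, runKeys, Finset.mem_product]
  exact ⟨Finset.mem_Icc.mpr (abs_le.mp (hA.abs_le _ _ hq.1)), shiftExcess_mem hkA _,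
    Finset.mem_Icc.mpr (abs_le.mp (hB.abs_le _ _ hq.2)), shiftExcess_mem hkB _, Finset.mem_univ _⟩

theorem fibSum_eq_of_runKey_eq {v v' : List γ} (hkey : runKey f g kA kB v = runKey f g kA kB v') :
    (fibSum 2 kA (v.map f) = fibSum 2 kA (v'.map f) ∧
      fibSum 3 kA (v.map f) = fibSum 3 kA (v'.map f)) ∧
    (fibSum 2 kB (v.map g) = fibSum 2 kB (v'.map g) ∧
      fibSum 3 kB (v.map g) = fibSum 3 kB (v'.map g)) ∧ v.getLast? = v'.getLast? := by
  simp only [runKey, shiftExcess, Prod.mk.injEq] at hkey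
  obtain ⟨h1, h2, h3, h4, h5⟩ := hkey
  rw [h1] at h2
  rw [h3] at h4
  exact ⟨⟨h1, by linarith⟩, ⟨h3, by linarith⟩, h5⟩

theorem ProductRun.of_eq (H : Elimination f g h y compA compB compD kA kB a b pA pB)
    (hA : Recognizes A compA kA cA R) (hB : Recognizes B compB kB cB R) {v v' : List γ}
    {q : A.State × B.State} (hq : ProductRun A f B g v q)
    (hv' : (v'.map h).IsChain compD ∧ Valid (v'.map y))
    (hA2 : fibSum 2 kA (v.map f) = fibSum 2 kA (v'.map f))
    (hA3 : fibSum 3 kA (v.map f) = fibSum 3 kA (v'.map f))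
    (hB2 : fibSum 2 kB (v.map g) = fibSum 2 kB (v'.map g))
    (hB3 : fibSum 3 kB (v.map g) = fibSum 3 kB (v'.map g))
    (hlast : v.getLast? = v'.getLast?) : ProductRun A f B g v' q := by
  obtain ⟨h1, h2⟩ := (H.isChain_iff v').mpr hv'
  constructor
  · rw [← hA.congr _ _ (hA.isChain _ _ hq.1) h1 hA2 hA3 (by simp [hlast]), hq.1]
  · rw [← hB.congr _ _ (hB.isChain _ _ hq.2) h2 hB2 hB3 (by simp [hlast]), hq.2]

/-- The digits of the right relation are bounded by 3, so its excess contributes only the constant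
factor 7. The factor 63 is 7 times at most 9 possible last letters (none included). -/
theorem card_product_le [Fintype γ] (hγ : Fintype.card γ ≤ 8)
    (H : Elimination f g h y compA compB compD kA kB a b pA pB)
    (hA : Recognizes A compA kA cA R) (hB : Recognizes B compB kB cB R)
    (hkA : ∀ l, |kA l| ≤ R) (hkB : ∀ l, |kB l| ≤ 3) :
    Nat.card (product A f B g).State ≤ (2 * R + 1) ^ 3 * 63 := by
  have hrun : ∀ q : (product A f B g).State, ∃ v, ProductRun A f B g v (pairOf q) := fun q =>
    (accessible_product q).imp fun v hv => runFrom_product_iff.mp hv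
  choose v hv using hrun
  refine le_trans ?_ (card_runKeys hγ R)
  refine card_le_card_of_injective (fun q => runKey f g kA kB (v q)) (fun q q' hqq => ?_) _
    fun q => (hv q).runKey_mem hA hB hkA hkB
  obtain ⟨⟨hA2, hA3⟩, ⟨hB2, hB3⟩, hlast⟩ := fibSum_eq_of_runKey_eq hqq
  exact pairOf_injective
    (((hv q).of_eq H hA hB ((hv q').isChain H hA hB) hA2 hA3 hB2 hB3 hlast).unique (hv q'))

/-- The data of a word, where the eliminated track has the least possible value, that determine
the subset reached on the visible part of the word. -/
noncomputable def subsetKey (f : γ → α) (g : γ → β) (y : γ → Fin 2) (kA : α → ℤ) (kB : β → ℤ)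
    (R : ℕ) (v : List γ) : (ℤ × ℤ × ℤ × ℤ × Option γ) × ℤ × ℕ :=
  (runKey f g kA kB v, shiftIncrSum (2 * R + 2) (value (v.map y)),
    min (Nat.fib (v.length + 2) - 1 - value (v.map y)) (2 * R))

/-- Both base words are moved to larger values of the eliminated track by the same amount `i`. The
sums then change equally, the shifted sums change equally because the increments agree, and so do
the new last letters. Thus a state reached over one visible word is also reached over the other. -/
theorem ProductRun.transfer (H : Elimination f g h y compA compB compD kA kB a b pA pB)
    (hA : Recognizes A compA kA cA R) (hB : Recognizes B compB kB cB R) {v v' u : List γ}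
    {q₀ q₀' q : A.State × B.State} (hv : ProductRun A f B g v q₀) (hv' : ProductRun A f B g v' q₀')
    (hkey : subsetKey f g y kA kB R v = subsetKey f g y kA kB R v')
    (hu : ProductRun A f B g u q) (huv : u.map h = v.map h)
    (hle : value (v.map y) ≤ value (u.map y)) :
    ∃ u', u'.map h = v'.map h ∧ ProductRun A f B g u' q := by
  simp only [subsetKey, Prod.mk.injEq] at hkey
  obtain ⟨hkey, hsum, hmin⟩ := hkey
  obtain ⟨⟨hA2, hA3⟩, ⟨hB2, hB3⟩, hlast⟩ := fibSum_eq_of_runKey_eq hkey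
  obtain ⟨hvc, hvv⟩ := hv.isChain H hA hB
  obtain ⟨hvc', hvv'⟩ := hv'.isChain H hA hB
  obtain ⟨huc, huu⟩ := hu.isChain H hA hB
  obtain ⟨i, hi⟩ := Nat.exists_eq_add_of_le hle
  have hlen : u.length = v.length := by simpa using congrArg List.length huv
  -- Both left sums lie in `[-R, R]` and differ by `pA * i` with `pA ≠ 0`.
  have hi2 : i ≤ 2 * R := by
    have h1 := abs_le.mp (hA.abs_le _ _ hv.1)
    have h2 := abs_le.mp (hA.abs_le _ _ hu.1)
    rw [H.fibSum_left, ← coe_value] at h1 h2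
    rw [huv, hi] at h2
    push_cast at h2
    have h3 : |pA * i| ≤ 2 * R := by
      rw [abs_le]
      constructor <;> linarith
    have h4 : 1 ≤ |pA| := Int.one_le_abs H.left_ne
    rw [abs_mul, Nat.abs_cast] at h3
    have h5 : (i : ℤ) ≤ 2 * R := by nlinarith [Int.natCast_nonneg i]
    exact_mod_cast h5
  -- The remaining room for larger values agrees in both words up to the cap `2 * R`, and `i` does
  -- not exceed the cap.
  have hbound : value (v'.map y) + i < Nat.fib (v'.length + 2) := by
    have h1 := value_lt huu
    have h2 := value_lt hvv'
    rw [List.length_map] at h1 h2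
    rw [hlen, hi] at h1
    omega
  obtain ⟨x, hx, hxv, hxy⟩ := exists_valid_value_eq _ hbound
  obtain ⟨u', hu1, hu2⟩ := H.exists_word (v'.map h) x (by simpa using hx)
  have hval : value (u'.map y) = value (v'.map y) + i := by rw [hu2, hxy]
  -- The index `i + 1` is needed for the last digit, which compares the shift at `Y + i` and at `Y +
  -- i + 1`; hence the sum of `2 * R + 2` increments in the key.
  have hincr : ∀ j ≤ i + 1, shiftIncr (value (v.map y)) j = shiftIncr (value (v'.map y)) j :=
    fun j hj => shiftIncr_eq_of_sum_eq hsum (by omega)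
  have hV : fibSum 2 digit (u.map y) = fibSum 2 digit (v.map y) + i ∧
      fibSum 2 digit (u'.map y) = fibSum 2 digit (v'.map y) + i := by
    simp only [← coe_value, hi, hval]
    push_cast
    exact ⟨rfl, rfl⟩
  have hT : fibSum 3 digit (u.map y) - fibSum 3 digit (v.map y) =
      fibSum 3 digit (u'.map y) - fibSum 3 digit (v'.map y) := by
    simp only [fibSum_shift_eq, hi, hval, shiftValue_add, hincr i (by omega)]
    ring
  refine ⟨u', hu1, hu.of_eq H hA hB ⟨by rw [hu1]; exact hvc', by rw [hu2]; exact hxv⟩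
    ?_ ?_ ?_ ?_ ?_⟩
  · rw [H.fibSum_left, H.fibSum_left] at hA2 ⊢
    rw [hu1, huv, hV.1, hV.2]
    linarith
  · rw [H.fibSum_left, H.fibSum_left] at hA3 ⊢
    rw [hu1, huv]
    linear_combination hA3 + pA * hT
  · rw [H.fibSum_right, H.fibSum_right] at hB2 ⊢
    rw [hu1, huv, hV.1, hV.2]
    linarith
  · rw [H.fibSum_right, H.fibSum_right] at hB3 ⊢
    rw [hu1, huv]
    linear_combination hB3 + pB * hT
  · have hlen' : u'.length = v'.length := by simpa using congrArg List.length hu1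
    cases hl : v.getLast? with
    | none =>
      have hv0 := List.getLast?_eq_none_iff.mp hl
      have hv0' := List.getLast?_eq_none_iff.mp (hlast ▸ hl)
      rw [hv0] at hlen
      rw [hv0'] at hlen'
      rw [List.length_eq_zero_iff.mp hlen, List.length_eq_zero_iff.mp hlen']
    | some l =>
      have hl' : v'.getLast? = some l := hlast ▸ hl
      have h1 : u.getLast?.map h = some (h l) := by
        rw [← List.getLast?_map, huv, List.getLast?_map, hl]
        rfl
      have h2 : u'.getLast?.map h = some (h l) := by
        rw [← List.getLast?_map, hu1, List.getLast?_map, hl']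
        rfl
      obtain ⟨e, he, heh⟩ := Option.map_eq_some_iff.mp h1
      obtain ⟨e', he', heh'⟩ := Option.map_eq_some_iff.mp h2
      have h3 := digit_getLast_eq huu (a := y e) (by rw [List.getLast?_map, he]; rfl)
      have h4 := digit_getLast_eq (x := u'.map y) (by rw [hu2]; exact hxv) (a := y e')
        (by rw [List.getLast?_map, he']; rfl)
      have h5 : digit (y e) = digit (y e') := by
        rw [h3, h4, hi, hval, add_assoc, add_assoc]
        simp only [shiftValue_add, hincr i (by omega), hincr (i + 1) le_rfl]
        ring
      have h6 : y e = y e' := by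
        rcases digit_eq (y e) with ⟨h7, h8⟩ | ⟨h7, h8⟩ <;>
          rcases digit_eq (y e') with ⟨h9, h10⟩ | ⟨h9, h10⟩ <;> rw [h7, h9] <;> omega
      rw [he, he', H.letter_ext e e' (heh.trans heh'.symm) h6]

theorem exists_word_of_state (S : (determinize (project (product A f B g) h)).State) :
    ∃ w : List δ, (∀ q, q ∈ members S ↔ ∃ v : List γ, v.map h = w ∧
      ProductRun A f B g v (pairOf q)) ∧ ∃ q, q ∈ members S := by
  obtain ⟨w, hw⟩ := accessible_accessiblePart _ S
  obtain ⟨h1, h2⟩ := runFrom_determinize_project hw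
  refine ⟨w, fun q => ?_, h2⟩
  refine (Set.ext_iff.mp h1 q).trans (exists_congr fun v => and_congr_right fun _ => ?_)
  exact runFrom_product_iff

/-- Over a fixed visible word the left sum determines the value of the eliminated track, since `pA ≠
0`. By uniqueness of valid representations of a given length this fixes the whole word, hence the
state. -/
theorem ncard_members_le (H : Elimination f g h y compA compB compD kA kB a b pA pB)
    (hA : Recognizes A compA kA cA R) (hB : Recognizes B compB kB cB R)
    (S : (determinize (project (product A f B g) h)).State) :
    (members S).ncard ≤ 2 * R + 1 := by
  obtain ⟨w, hw, -⟩ := exists_word_of_state S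
  have hrun : ∀ q : (product A f B g).State, ∃ v : List γ,
      q ∈ members S → v.map h = w ∧ ProductRun A f B g v (pairOf q) := by
    intro q
    by_cases hq : q ∈ members S
    · exact ((hw q).mp hq).imp fun v hv _ => hv
    · exact ⟨[], fun h => absurd h hq⟩
  choose v hv using hrun
  have hcard : (Finset.Icc (-(R : ℤ)) R).card = 2 * R + 1 := by
    rw [Int.card_Icc]
    omega
  rw [← hcard, ← Set.ncard_coe_finset]
  refine Set.ncard_le_ncard_of_injOn (fun q => fibSum 2 kA ((v q).map f)) ?_ ?_
  · intro q hq
    exact Finset.mem_coe.mpr (Finset.mem_Icc.mpr (abs_le.mp (hA.abs_le _ _ (hv q hq).2.1)))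
  · intro q hq q' hq' heq
    obtain ⟨h1, h2⟩ := hv q hq
    obtain ⟨h3, h4⟩ := hv q' hq'
    simp only [H.fibSum_left, h1, h3, add_right_inj, mul_eq_mul_left_iff, H.left_ne, or_false,
      ← coe_value, Nat.cast_inj] at heq
    have h5 := (h2.isChain H hA hB).2.eq_of_value_eq (h4.isChain H hA hB).2
      (by simpa using congrArg List.length (h1.trans h3.symm)) heq
    rw [H.word_ext (h1.trans h3.symm) h5] at h2
    exact pairOf_injective (h2.unique h4)

/-- Each subset is encoded by the key of a run with the least eliminated value. Minimality makes
every other run an upward move, so equal keys give inclusions in both directions. The factor `2 * R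
+ 3` counts the sums of increments, `2 * R + 1` the capped room. -/
theorem card_determinize_le [Fintype γ] (hγ : Fintype.card γ ≤ 8)
    (H : Elimination f g h y compA compB compD kA kB a b pA pB)
    (hA : Recognizes A compA kA cA R) (hB : Recognizes B compB kB cB R)
    (hkA : ∀ l, |kA l| ≤ R) (hkB : ∀ l, |kB l| ≤ 3) :
    Nat.card (determinize (project (product A f B g) h)).State ≤
      (2 * R + 1) ^ 3 * 63 * ((2 * R + 3) * (2 * R + 1)) := by
  have hbase : ∀ S : (determinize (project (product A f B g) h)).State, ∃ v : List γ,
      (∀ q, q ∈ members S ↔ ∃ u : List γ, u.map h = v.map h ∧ ProductRun A f B g u (pairOf q)) ∧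
      (∃ q, ProductRun A f B g v q) ∧
      ∀ u q, u.map h = v.map h → ProductRun A f B g u q → value (v.map y) ≤ value (u.map y) := by
    intro S
    obtain ⟨w, hw, hne⟩ := exists_word_of_state S
    have hex : ∃ n, ∃ v : List γ, v.map h = w ∧ (∃ q, ProductRun A f B g v q) ∧
        value (v.map y) = n := by
      obtain ⟨q, hq⟩ := hne
      obtain ⟨v, hv, hr⟩ := (hw q).mp hq
      exact ⟨_, v, hv, ⟨_, hr⟩, rfl⟩
    classical
    obtain ⟨v, hv, hr, hval⟩ := Nat.find_spec hex
    refine ⟨v, by rw [hv]; exact hw, hr, fun u q hu hq => ?_⟩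
    rw [hval]
    exact Nat.find_min' hex ⟨u, hu.trans hv, ⟨q, hq⟩, rfl⟩
  choose v hset hrun hmin using hbase
  let T : Finset ((ℤ × ℤ × ℤ × ℤ × Option γ) × ℤ × ℕ) :=
    runKeys γ R ×ˢ Finset.Icc (0 : ℤ) (2 * R + 2 : ℕ) ×ˢ Finset.range (2 * R + 1)
  have hT : T.card ≤ (2 * R + 1) ^ 3 * 63 * ((2 * R + 3) * (2 * R + 1)) := by
    rw [Finset.card_product, Finset.card_product, Int.card_Icc, Finset.card_range]
    refine Nat.mul_le_mul (card_runKeys hγ R) (Nat.mul_le_mul_right _ ?_)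
    omega
  refine le_trans ?_ hT
  have hsub : ∀ S S', subsetKey f g y kA kB R (v S) = subsetKey f g y kA kB R (v S') →
      members S ⊆ members S' := by
    intro S S' hkey q hq
    obtain ⟨u, hu, hr⟩ := (hset S q).mp hq
    obtain ⟨q₀, hq₀⟩ := hrun S
    obtain ⟨q₀', hq₀'⟩ := hrun S'
    exact (hset S' q).mpr (hq₀.transfer H hA hB hq₀' hkey hr hu (hmin S u _ hu hr))
  refine card_le_card_of_injective (fun S => subsetKey f g y kA kB R (v S)) (fun S S' hkey => ?_) T
    fun S => ?_
  · exact Subtype.ext ((hsub S S' hkey).antisymm (hsub S' S hkey.symm))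
  · obtain ⟨q, hq⟩ := hrun S
    simp only [subsetKey, T, Finset.mem_product]
    exact ⟨hq.runKey_mem hA hB hkA hkB, shiftIncrSum_mem _ _, Finset.mem_range.mpr (by omega)⟩

end Count

/-! ### The time of one combination -/

/-- A bound for the time of a combination with the parameter `m`. -/
def combineCost (m : ℕ) : ℕ := 2 ^ 15 * 214 * 4096 * 3 * (m ^ 6 * (1 + Nat.log 2 m))

theorem combineCost_mono {m m' : ℕ} (h : m ≤ m') : combineCost m ≤ combineCost m' := by
  have := Nat.log_mono_right (b := 2) h
  unfold combineCost
  gcongr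

theorem log_pow_five_le {R : ℕ} (hR : 1 ≤ R) :
    Nat.log 2 (2 ^ 15 * R ^ 5) + 1 ≤ 16 + 5 * (Nat.log 2 R + 1) := by
  have h1 : R < 2 ^ (Nat.log 2 R + 1) := Nat.lt_pow_succ_log_self one_lt_two R
  have h2 : 2 ^ 15 * R ^ 5 < 2 ^ (15 + 5 * (Nat.log 2 R + 1)) := by
    rw [pow_add, mul_comm 5, pow_mul]
    gcongr
  have h3 := Nat.log_lt_of_lt_pow (by positivity) h2
  omega

/-- The dominant term is the subset construction: `O(R^5)` subsets with `O(R)` elements each.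
Minimization contributes `O(R^5 log R)`. -/
theorem Elimination.time_le [Fintype γ] [Fintype δ] (hγ : Fintype.card γ ≤ 8)
    (hδ : Fintype.card δ ≤ 4) {f : γ → α} {g : γ → β} {h : γ → δ} {y : γ → Fin 2}
    {compA : α → α → Prop} {compB : β → β → Prop} {compD : δ → δ → Prop}
    {kA : α → ℤ} {kB : β → ℤ} {a b : δ → ℤ} {pA pB : ℤ} {A : PDFA α} {B : PDFA β} {cA cB : ℤ}
    {m : ℕ} (hm : 1 ≤ m) (H : Elimination f g h y compA compB compD kA kB a b pA pB)
    (hA : Recognizes A compA kA cA (4 * m)) (hB : Recognizes B compB kB cB (4 * m))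
    (hkA : ∀ l, |kA l| ≤ 4 * m) (hkB : ∀ l, |kB l| ≤ 3) {M : PDFA δ} {t : ℕ}
    (hM : Combine A f B g h M t) : t ≤ combineCost m := by
  set R := 4 * m with hRdef
  have hR : 1 ≤ R := by omega
  have hkA' : ∀ l, |kA l| ≤ R := fun l => (hkA l).trans (by rw [hRdef]; push_cast; rfl)
  have h1 : 2 * R + 1 ≤ 3 * R := by omega
  have h2 : 2 * R + 3 ≤ 5 * R := by omega
  have hN : (2 * R + 1) ^ 3 * 63 * ((2 * R + 3) * (2 * R + 1)) ≤ 2 ^ 15 * R ^ 5 :=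
    calc _ ≤ (3 * R) ^ 3 * 63 * ((5 * R) * (3 * R)) := by gcongr
      _ = 25515 * R ^ 5 := by ring
      _ ≤ _ := Nat.mul_le_mul_right _ (by norm_num)
  have hP := card_product_le hγ H hA hB hkA' hkB
  have hD := card_determinize_le hγ H hA hB hkA' hkB
  have ht := hM.time_le (N := 2 ^ 15 * R ^ 5) (K := 2 * R + 1)
    (hP.trans ((Nat.le_mul_of_pos_right _ (by positivity)).trans hN)) (hD.trans hN)
    (ncard_members_le H hA hB)
  refine ht.trans ?_
  have hlog := log_pow_five_le hR
  have hlogR : Nat.log 2 R = Nat.log 2 m + 2 := by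
    rw [hRdef, show 4 * m = m * 2 * 2 by ring, Nat.log_mul_base one_lt_two (by omega),
      Nat.log_mul_base one_lt_two (by omega)]
  -- The constant terms and the coefficient of `R` add up to `190 + 24 = 214`; the factor `4096 = 4
  -- ^ 6` comes from `R = 4 * m`, and the 3 from `1 + log R = 3 + log m`.
  calc _ ≤ 2 ^ 15 * R ^ 5 * (1 + 2 * 8 + (3 * R) * 8 + (1 + 4) +
          2 * 4 * (16 + 5 * (Nat.log 2 R + 1))) := by gcongr
    _ ≤ 2 ^ 15 * R ^ 5 * (R * (214 * (1 + Nat.log 2 R))) := by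
      gcongr
      nlinarith [Nat.zero_le (Nat.log 2 R), Nat.mul_le_mul_right (Nat.log 2 R) hR]
    _ = 2 ^ 15 * 214 * 4096 * (m ^ 6 * (3 + Nat.log 2 m)) := by
      rw [hlogR, hRdef]
      ring
    _ ≤ 2 ^ 15 * 214 * 4096 * (m ^ 6 * (3 * (1 + Nat.log 2 m))) := by
      gcongr
      omega
    _ = _ := by
      rw [combineCost]
      ring

/-! ### Digits -/

theorem abs_digit_le (l : Fin 2) : |digit l| ≤ (1 : ℕ) := by
  rcases digit_eq l with ⟨-, h⟩ | ⟨-, h⟩ <;> rw [h] <;> simp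

theorem abs_mulDigit_le {n : ℕ} (hn : 1 ≤ n) (l : Fin 2 × Fin 2) : |mulDigit n l| ≤ n := by
  rw [mulDigit, abs_le]
  rcases digit_eq l.1 with ⟨-, h⟩ | ⟨-, h⟩ <;> rcases digit_eq l.2 with ⟨-, h'⟩ | ⟨-, h'⟩ <;>
    rw [h, h'] <;> omega

theorem abs_digitDiff_le (l : Fin 2 × Fin 2 × Fin 2) : |digitDiff l| ≤ 3 := by
  have := digitDiff_bounds l
  rw [abs_le]
  omega

theorem fibSum_zero (j : ℕ) (w : List α) : fibSum j (fun _ => 0) w = 0 := by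
  induction w with
  | nil => rfl
  | cons a w ih => simp [fibSum, ih]

theorem fibSum_mul_fst (n : ℕ) (w : List (Fin 2 × Fin 2)) :
    fibSum 2 (fun l => (n : ℤ) * digit l.1) w = n * value (w.map Prod.fst) := by
  rw [coe_value, fibSum_map, fibSum_linear (p := n) (q := 0)
    (k₁ := fun l : Fin 2 × Fin 2 => digit l.1) (k₂ := fun _ => 0)]
  · ring
  · intro l
    ring

theorem fibSum_mulDigit_value (n : ℕ) (w : List (Fin 2 × Fin 2)) :
    fibSum 2 (mulDigit n) w = n * value (w.map Prod.fst) - value (w.map Prod.snd) := by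
  rw [fibSum_mulDigit, coe_value, coe_value]

theorem exists_digits (c : ℕ) : ∃ w : List (Fin 2), w.IsChain DigitCompat ∧ fibSum 2 digit w = c := by
  obtain ⟨x, -, hx, h⟩ := exists_valid_value_eq c (Y := c) (by
    have h1 := Nat.le_fib_add_one (c + 2)
    omega)
  exact ⟨x, hx, by rw [← coe_value, h]⟩

theorem exists_pairs (n c : ℕ) :
    ∃ w : List (Fin 2 × Fin 2), w.IsChain PairCompat ∧ fibSum 2 (mulDigit n) w = -c := by
  obtain ⟨x, hx, h⟩ := exists_digits c
  refine ⟨x.map fun d => (0, d), ?_, ?_⟩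
  · rw [List.isChain_map]
    refine hx.imp fun d e hde => ⟨by simp [DigitCompat], hde⟩
  · rw [fibSum_map, fibSum_linear (p := -1) (q := 0) (k₁ := digit) (k₂ := fun _ => 0), h]
    · ring
    · intro d
      simp [mulDigit, digit]

theorem value_snd_lt {w : List (Fin 2 × Fin 2)} (hw : w.IsChain PairCompat) :
    value (w.map Prod.snd) < Nat.fib (w.length + 2) := by
  simpa using value_lt (isChain_pairCompat.mp hw).2

/-! ### The recursive constructions -/

theorem BuildSucc.spec {S : PDFA (Fin 2 × Fin 2)} {t : ℕ} (h : BuildSucc S t) :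
    Recognizes S PairCompat (mulDigit 1) (-1) 4 ∧ t ≤ combineCost 1 := by
  have H : Elimination (fun l : Fin 2 × Fin 2 × Fin 2 => l.2.1) id (fun l => (l.1, l.2.2))
      (fun l => l.2.1) DigitCompat TripleCompat PairCompat digit digitDiff (fun _ => 0)
      (mulDigit 1) 1 1 := by
    refine ⟨by decide, by decide, ?_, ?_, ?_, one_ne_zero⟩
    · intro l l'
      simp only [TripleCompat, PairCompat, id]
      tauto
    · intro l
      ring
    · intro l
      simp only [digitDiff_eq, mulDigit, id]
      push_cast
      ring
  have hspec := H.spec recognizes_oneAut recognizes_addAut h (k := mulDigit 1) (c := -1)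
    (exists_pairs 1 1) fun w hw => by
      have hlt := value_snd_lt hw
      rw [fibSum_zero, fibSum_mulDigit_value]
      constructor
      · intro h1
        exact ⟨1, by omega, by simp, by push_cast at h1 ⊢; linarith⟩
      · rintro ⟨Y, -, h1, h2⟩
        push_cast at h1 h2 ⊢
        linarith
  exact ⟨.of_isMinimal hspec.1 hspec.2 (abs_mulDigit_le le_rfl) (by norm_num) (by norm_num),
    H.time_le (by decide) (by decide) le_rfl recognizes_oneAut recognizes_addAut
      (fun l => (abs_digit_le l).trans (by norm_num)) abs_digitDiff_le h⟩

/-- The term `2 * Nat.log 2 c + c % 2` bounds the depth of the recursion: halving lowers the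
logarithm by one, and an odd step only leads to an even number. It is doubled because an odd step
also builds the successor automaton. The 3 bounds the size of the base automaton and must be kept
apart, as `combineCost 0 = 0`. -/
theorem BuildConst.spec {c : ℕ} {M : PDFA (Fin 2)} {t : ℕ} (h : BuildConst c M t) :
    (∀ m, 1 ≤ m → c ≤ m → Recognizes M DigitCompat digit c (4 * m)) ∧
      t ≤ 3 + 2 * (2 * Nat.log 2 c + c % 2) * combineCost c := by
  induction h with
  | zero =>
    refine ⟨fun m hm _ => recognizes_zeroAut.mono (by omega), ?_⟩
    have h1 := zeroAut.size_le
    have h2 : Nat.card zeroAut.State = 1 := Nat.card_unique (α := Unit)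
    rw [h2] at h1
    simpa [combineCost] using h1
  | even k A M s t hk hA hM ih =>
    obtain ⟨hrec, hs⟩ := ih
    have H : Elimination (fun l : Fin 2 × Fin 2 => l.1) (fun l => (l.1, l.1, l.2)) (fun l => l.2)
        (fun l => l.1) DigitCompat TripleCompat DigitCompat digit digitDiff (fun _ => 0)
        (fun l => -digit l) 1 2 := by
      refine ⟨by decide, by decide, ?_, ?_, ?_, one_ne_zero⟩
      · intro l l'
        simp only [TripleCompat]
        tauto
      · intro l
        ring
      · intro l
        simp only [digitDiff_eq]
        ring
    have hA' := hrec (2 * k) (by omega) (by omega)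
    have hB' := recognizes_addAut.mono (R' := 4 * (2 * k)) (by omega)
    have hspec := H.spec hA' hB' hM (k := digit) (c := (2 * k : ℕ)) (exists_digits _)
      fun w hw => by
        have hlt := value_lt hw
        rw [fibSum_zero, fibSum_linear (k := fun l => -digit l) (p := -1) (q := 0) (k₁ := digit)
          (k₂ := fun _ => 0) (by intro l; ring), ← coe_value]
        constructor
        · intro h1
          have h1' : value w = 2 * k := by exact_mod_cast h1
          exact ⟨k, by omega, by simp, by rw [h1']; push_cast; ring⟩
        · rintro ⟨Y, -, h1, h2⟩
          push_cast at h1 h2 ⊢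
          linarith
    refine ⟨fun m hm hcm => .of_isMinimal hspec.1 hspec.2 abs_digit_le (by omega) ?_, ?_⟩
    · rw [Nat.abs_cast]
      push_cast
      omega
    · have ht := H.time_le (by decide) (by decide) (by omega) hA' hB'
        (fun l => (abs_digit_le l).trans (by push_cast; omega)) abs_digitDiff_le hM
      have hmono := combineCost_mono (show k ≤ 2 * k by omega)
      have hlog : Nat.log 2 (2 * k) = Nat.log 2 k + 1 := by
        rw [mul_comm, Nat.log_mul_base one_lt_two (by omega)]
      have hmod : k % 2 ≤ 1 := by omega
      rw [hlog, show 2 * k % 2 = 0 by omega]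
      calc s + t ≤ (3 + 2 * (2 * Nat.log 2 k + 1) * combineCost (2 * k)) + combineCost (2 * k) :=
            add_le_add (hs.trans (by gcongr)) ht
        _ ≤ _ := by nlinarith [Nat.zero_le (combineCost (2 * k))]
  | odd k A M S s u t hA hS hM ih =>
    obtain ⟨hrec, hs⟩ := ih
    obtain ⟨hSrec, hu⟩ := hS.spec
    have H : Elimination (fun l : Fin 2 × Fin 2 => l.1) id (fun l => l.2) (fun l => l.1)
        DigitCompat PairCompat DigitCompat digit (mulDigit 1) (fun _ => 0)
        (fun l => -digit l) 1 1 := by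
      refine ⟨by decide, by decide, ?_, ?_, ?_, one_ne_zero⟩
      · intro l l'
        simp only [PairCompat, id]
        tauto
      · intro l
        ring
      · intro l
        simp only [mulDigit, id]
        push_cast
        ring
    have hA' := hrec (2 * k + 1) (by omega) (by omega)
    have hB' := hSrec.mono (R' := 4 * (2 * k + 1)) (by omega)
    have hspec := H.spec hA' hB' hM (k := digit) (c := (2 * k + 1 : ℕ)) (exists_digits _)
      fun w hw => by
        have hlt := value_lt hw
        rw [fibSum_zero, fibSum_linear (k := fun l => -digit l) (p := -1) (q := 0) (k₁ := digit)
          (k₂ := fun _ => 0) (by intro l; ring), ← coe_value]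
        constructor
        · intro h1
          have h1' : value w = 2 * k + 1 := by exact_mod_cast h1
          exact ⟨2 * k, by omega, by simp, by rw [h1']; push_cast; ring⟩
        · rintro ⟨Y, -, h1, h2⟩
          push_cast at h1 h2 ⊢
          linarith
    refine ⟨fun m hm hcm => .of_isMinimal hspec.1 hspec.2 abs_digit_le (by omega) ?_, ?_⟩
    · rw [Nat.abs_cast]
      push_cast
      omega
    · have ht := H.time_le (by decide) (by decide) (by omega) hA' hB'
        (fun l => (abs_digit_le l).trans (by push_cast; omega))
        (fun l => (abs_mulDigit_le le_rfl l).trans (by norm_num)) hM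
      have hmono := combineCost_mono (show 2 * k ≤ 2 * k + 1 by omega)
      have hmono' := combineCost_mono (show 1 ≤ 2 * k + 1 by omega)
      have hlog : Nat.log 2 (2 * k) ≤ Nat.log 2 (2 * k + 1) := Nat.log_mono_right (by omega)
      rw [show 2 * k % 2 = 0 by omega] at hs
      rw [show (2 * k + 1) % 2 = 1 by omega]
      calc s + u + t ≤ (3 + 2 * (2 * Nat.log 2 (2 * k + 1) + 0) * combineCost (2 * k + 1)) +
            combineCost (2 * k + 1) + combineCost (2 * k + 1) :=
            add_le_add (add_le_add (hs.trans (by gcongr)) (hu.trans hmono')) ht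
        _ = _ := by ring

theorem exists_buildConst (c : ℕ) : ∃ M t, BuildConst c M t := by
  induction c using Nat.strong_induction_on with
  | _ c ih =>
    have heven : ∀ k, 1 ≤ k → (∃ M t, BuildConst k M t) → ∃ M t, BuildConst (2 * k) M t := by
      rintro k hk ⟨A, s, hA⟩
      obtain ⟨M, t, hM⟩ := exists_combine A (fun l : Fin 2 × Fin 2 => l.1) addAut
        (fun l => (l.1, l.1, l.2)) (fun l => l.2)
      exact ⟨M, _, .even k A M s t hk hA hM⟩
    obtain ⟨k, rfl | rfl⟩ := Nat.even_or_odd' c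
    · rcases Nat.eq_zero_or_pos k with rfl | hk
      · exact ⟨_, _, .zero⟩
      · exact heven k hk (ih k (by omega))
    · obtain ⟨A, s, hA⟩ := ih (2 * k) (by omega)
      obtain ⟨S, u, hS⟩ := exists_combine oneAut (fun l : Fin 2 × Fin 2 × Fin 2 => l.2.1) addAut id
        (fun l => (l.1, l.2.2))
      obtain ⟨M, t, hM⟩ := exists_combine A (fun l : Fin 2 × Fin 2 => l.1) S id (fun l => l.2)
      exact ⟨M, _, .odd k A M S s u t hA hS hM⟩

theorem BuildShift.spec {c : ℕ} {M : PDFA (Fin 2 × Fin 2)} {t : ℕ} (h : BuildShift c M t) {m : ℕ}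
    (hm : 1 ≤ m) (hcm : c ≤ m) :
    Recognizes M PairCompat (mulDigit 1) (-c) (4 * m) ∧
      t ≤ 3 + 2 * (2 * Nat.log 2 c + c % 2) * combineCost c + combineCost m := by
  obtain ⟨A, s, u, hA, hM, rfl⟩ := h
  obtain ⟨hrec, hs⟩ := hA.spec
  have H : Elimination id (fun l : Fin 2 × Fin 2 × Fin 2 => l.2.1) (fun l => (l.1, l.2.2))
      (fun l => l.2.1) TripleCompat DigitCompat PairCompat digitDiff digit (mulDigit 1)
      (fun _ => 0) 1 1 := by
    refine ⟨by decide, by decide, ?_, ?_, ?_, one_ne_zero⟩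
    · intro l l'
      simp only [TripleCompat, PairCompat, id]
      tauto
    · intro l
      simp only [digitDiff_eq, mulDigit, id]
      push_cast
      ring
    · intro l
      ring
  have hA' := recognizes_addAut.mono (R' := 4 * m) (by omega)
  have hB' := hrec m hm hcm
  have hspec := H.spec hA' hB' hM (k := mulDigit 1) (c := -c) (exists_pairs 1 c) fun w hw => by
    have hlt := value_snd_lt hw
    rw [fibSum_zero, fibSum_mulDigit_value]
    constructor
    · intro h1
      exact ⟨c, by omega, by push_cast at h1 ⊢; linarith, by ring⟩
    · rintro ⟨Y, -, h1, h2⟩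
      push_cast at h1 h2 ⊢
      linarith
  refine ⟨.of_isMinimal hspec.1 hspec.2 (abs_mulDigit_le le_rfl) (by omega) ?_, ?_⟩
  · rw [abs_neg, Nat.abs_cast]
    push_cast
    omega
  · exact add_le_add hs (H.time_le (by decide) (by decide) hm hA' hB'
      (fun l => (abs_digitDiff_le l).trans (by omega))
      (fun l => (abs_digit_le l).trans (by norm_num)) hM)

theorem exists_buildShift (c : ℕ) : ∃ M t, BuildShift c M t := by
  obtain ⟨A, s, hA⟩ := exists_buildConst c
  obtain ⟨M, u, hM⟩ := exists_combine addAut id A (fun l : Fin 2 × Fin 2 × Fin 2 => l.2.1)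
    (fun l => (l.1, l.2.2))
  exact ⟨M, _, A, s, u, hA, hM, rfl⟩

/-- The recursion depth is counted as for constants; here the base automaton, at `n = 1`, is
absorbed by the term `n % 2`. The radius is left as `4 * m` for every `m ≥ n`, since the next step
needs it for its own, larger multiplier. -/
theorem BuildMul.spec {n : ℕ} {M : PDFA (Fin 2 × Fin 2)} {t : ℕ} (h : BuildMul n M t) :
    1 ≤ n ∧ (∀ m, n ≤ m → Recognizes M PairCompat (mulDigit n) 0 (4 * m)) ∧
      t ≤ (2 * Nat.log 2 n + n % 2) * combineCost n := by
  induction h with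
  | one =>
    refine ⟨le_rfl, fun m hm => recognizes_eqAut.mono (by omega), ?_⟩
    have h1 := eqAut.size_le
    have h2 : Nat.card eqAut.State = 2 := Nat.card_fin 2
    rw [h2] at h1
    refine h1.trans ?_
    simp [combineCost]
  | even k A M s t hk hA hM ih =>
    obtain ⟨-, hrec, hs⟩ := ih
    have H : Elimination (fun l : Fin 2 × Fin 2 × Fin 2 => (l.1, l.2.1))
        (fun l => (l.2.1, l.2.1, l.2.2)) (fun l => (l.1, l.2.2)) (fun l => l.2.1)
        PairCompat TripleCompat PairCompat (mulDigit k) digitDiff (fun l => k * digit l.1)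
        (mulDigit 0) (-1) 2 := by
      refine ⟨by decide, by decide, ?_, ?_, ?_, by norm_num⟩
      · intro l l'
        simp only [TripleCompat, PairCompat]
        tauto
      · intro l
        simp only [mulDigit]
        ring
      · intro l
        simp only [digitDiff_eq, mulDigit]
        push_cast
        ring
    have hA' := hrec (2 * k) (by omega)
    have hB' := recognizes_addAut.mono (R' := 4 * (2 * k)) (by omega)
    have hspec := H.spec hA' hB' hM (k := mulDigit (2 * k)) (c := 0)
      ⟨[], List.isChain_nil, rfl⟩ fun w hw => by
        have hlt := value_snd_lt hw
        rw [fibSum_mul_fst, fibSum_mulDigit_value, fibSum_mulDigit_value]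
        constructor
        · intro h1
          have h1' : 2 * (k * value (w.map Prod.fst)) = value (w.map Prod.snd) := by
            push_cast at h1
            zify
            linarith
          exact ⟨k * value (w.map Prod.fst), by omega, by push_cast; ring, by
            push_cast at h1 ⊢
            linarith⟩
        · rintro ⟨Y, -, h1, h2⟩
          push_cast at h1 h2 ⊢
          linarith
    refine ⟨by omega, fun m hm => .of_isMinimal hspec.1 hspec.2
      (abs_mulDigit_le (by omega)) (by omega) (by simp), ?_⟩
    have ht := H.time_le (by decide) (by decide) (by omega) hA' hB'
      (fun l => (abs_mulDigit_le hk l).trans (by push_cast; omega)) abs_digitDiff_le hM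
    have hmono := combineCost_mono (show k ≤ 2 * k by omega)
    have hlog : Nat.log 2 (2 * k) = Nat.log 2 k + 1 := by
      rw [mul_comm, Nat.log_mul_base one_lt_two (by omega)]
    have hmod : k % 2 ≤ 1 := by omega
    rw [hlog, show 2 * k % 2 = 0 by omega]
    calc s + t ≤ (2 * Nat.log 2 k + 1) * combineCost (2 * k) + combineCost (2 * k) :=
          add_le_add (hs.trans (by gcongr)) ht
      _ = _ := by ring
  | odd k A M s t hk hA hM ih =>
    obtain ⟨-, hrec, hs⟩ := ih
    have H : Elimination (fun l : Fin 2 × Fin 2 × Fin 2 => (l.1, l.2.1)) id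
        (fun l => (l.1, l.2.2)) (fun l => l.2.1) PairCompat TripleCompat PairCompat
        (mulDigit (2 * k)) digitDiff (fun l => (2 * k : ℕ) * digit l.1) (mulDigit 1) (-1) 1 := by
      refine ⟨by decide, by decide, ?_, ?_, ?_, by norm_num⟩
      · intro l l'
        simp only [TripleCompat, PairCompat, id]
        tauto
      · intro l
        simp only [mulDigit]
        ring
      · intro l
        simp only [digitDiff_eq, mulDigit, id]
        push_cast
        ring
    have hA' := hrec (2 * k + 1) (by omega)
    have hB' := recognizes_addAut.mono (R' := 4 * (2 * k + 1)) (by omega)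
    have hspec := H.spec hA' hB' hM (k := mulDigit (2 * k + 1)) (c := 0)
      ⟨[], List.isChain_nil, rfl⟩ fun w hw => by
        have hlt := value_snd_lt hw
        rw [fibSum_mul_fst, fibSum_mulDigit_value, fibSum_mulDigit_value]
        constructor
        · intro h1
          have h1' : 2 * k * value (w.map Prod.fst) + value (w.map Prod.fst) =
              value (w.map Prod.snd) := by
            push_cast at h1
            zify
            linarith
          exact ⟨2 * k * value (w.map Prod.fst), by omega, by push_cast; ring, by
            push_cast at h1 ⊢
            linarith⟩
        · rintro ⟨Y, -, h1, h2⟩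
          push_cast at h1 h2 ⊢
          linarith
    refine ⟨by omega, fun m hm => .of_isMinimal hspec.1 hspec.2
      (abs_mulDigit_le (by omega)) (by omega) (by simp), ?_⟩
    have ht := H.time_le (by decide) (by decide) (by omega) hA' hB'
      (fun l => (abs_mulDigit_le (by omega) l).trans (by push_cast; omega)) abs_digitDiff_le hM
    have hmono := combineCost_mono (show 2 * k ≤ 2 * k + 1 by omega)
    have hlog : Nat.log 2 (2 * k) ≤ Nat.log 2 (2 * k + 1) := Nat.log_mono_right (by omega)
    rw [show 2 * k % 2 = 0 by omega] at hs
    rw [show (2 * k + 1) % 2 = 1 by omega]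
    calc s + t ≤ (2 * Nat.log 2 (2 * k + 1) + 0) * combineCost (2 * k + 1) +
          combineCost (2 * k + 1) := add_le_add (hs.trans (by gcongr)) ht
      _ = _ := by ring

theorem exists_buildMul {n : ℕ} (hn : 1 ≤ n) : ∃ M t, BuildMul n M t := by
  induction n using Nat.strong_induction_on with
  | _ n ih =>
    obtain ⟨k, rfl | rfl⟩ := Nat.even_or_odd' n
    · obtain ⟨A, s, hA⟩ := ih k (by omega) (by omega)
      obtain ⟨M, t, hM⟩ := exists_combine A (fun l : Fin 2 × Fin 2 × Fin 2 => (l.1, l.2.1)) addAut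
        (fun l => (l.2.1, l.2.1, l.2.2)) (fun l => (l.1, l.2.2))
      exact ⟨M, _, .even k A M s t (by omega) hA hM⟩
    · rcases Nat.eq_zero_or_pos k with rfl | hk
      · exact ⟨_, _, .one⟩
      · obtain ⟨A, s, hA⟩ := ih (2 * k) (by omega) (by omega)
        obtain ⟨M, t, hM⟩ := exists_combine A (fun l : Fin 2 × Fin 2 × Fin 2 => (l.1, l.2.1))
          addAut id (fun l => (l.1, l.2.2))
        exact ⟨M, _, .odd k A M s t hk hA hM⟩

/-- Since `c < n`, the shift automaton also has sums bounded by `4 * n`, so that the final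
combination is again an elimination with parameter `n`. -/
theorem BuildLinear.spec {n c : ℕ} (hn : 1 ≤ n) (hc : c < n) {M : PDFA (Fin 2 × Fin 2)} {t : ℕ}
    (h : BuildLinear n c M t) :
    M.IsMinimal ∧ (∀ w, w ∈ M.language ↔ w.IsChain PairCompat ∧ fibSum 2 (mulDigit n) w = -c) ∧
      t ≤ 8 * (1 + Nat.log 2 n) * combineCost n := by
  obtain ⟨A, B, s, u, v, hA, hB, hM, rfl⟩ := h
  obtain ⟨-, hrec, hs⟩ := hA.spec
  obtain ⟨hB', hu⟩ := hB.spec hn hc.le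
  have H : Elimination (fun l : Fin 2 × Fin 2 × Fin 2 => (l.1, l.2.1)) (fun l => (l.2.1, l.2.2))
      (fun l => (l.1, l.2.2)) (fun l => l.2.1) PairCompat PairCompat PairCompat
      (mulDigit n) (mulDigit 1) (fun l => n * digit l.1) (mulDigit 0) (-1) 1 := by
    refine ⟨by decide, by decide, ?_, ?_, ?_, by norm_num⟩
    · intro l l'
      simp only [PairCompat]
      tauto
    · intro l
      simp only [mulDigit]
      ring
    · intro l
      simp only [mulDigit]
      push_cast
      ring
  have hA' := hrec n le_rfl
  have hspec := H.spec hA' hB' hM (k := mulDigit n) (c := -c) (exists_pairs n c) fun w hw => by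
    have hlt := value_snd_lt hw
    rw [fibSum_mul_fst, fibSum_mulDigit_value, fibSum_mulDigit_value]
    constructor
    · intro h1
      have h1' : n * value (w.map Prod.fst) + c = value (w.map Prod.snd) := by
        zify
        linarith
      exact ⟨n * value (w.map Prod.fst), by omega, by push_cast; ring, by
        push_cast
        linarith⟩
    · rintro ⟨Y, -, h1, h2⟩
      push_cast at h1 h2 ⊢
      linarith
  refine ⟨hspec.1, hspec.2, ?_⟩
  have hv := H.time_le (by decide) (by decide) hn hA' hB'
    (fun l => (abs_mulDigit_le hn l).trans (by omega))
    (fun l => (abs_mulDigit_le le_rfl l).trans (by norm_num)) hM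
  have hmono := combineCost_mono hc.le
  have hlog : Nat.log 2 c ≤ Nat.log 2 n := Nat.log_mono_right hc.le
  have h1 : n % 2 ≤ 1 := by omega
  have h2 : c % 2 ≤ 1 := by omega
  have h3 : 3 ≤ combineCost n := (show 3 ≤ combineCost 1 by simp [combineCost]).trans
    (combineCost_mono hn)
  calc s + u + v ≤ (2 * Nat.log 2 n + 1) * combineCost n +
        (combineCost n + 2 * (2 * Nat.log 2 n + 1) * combineCost n + combineCost n) +
        combineCost n := by
          refine add_le_add (add_le_add (hs.trans ?_) (hu.trans ?_)) hv <;> gcongr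
    _ ≤ _ := by nlinarith [Nat.zero_le (Nat.log 2 n * combineCost n)]

theorem exists_buildLinear {n : ℕ} (hn : 1 ≤ n) (c : ℕ) : ∃ M t, BuildLinear n c M t := by
  obtain ⟨A, s, hA⟩ := exists_buildMul hn
  obtain ⟨B, u, hB⟩ := exists_buildShift c
  obtain ⟨M, v, hM⟩ := exists_combine A (fun l : Fin 2 × Fin 2 × Fin 2 => (l.1, l.2.1)) B
    (fun l => (l.2.1, l.2.2)) (fun l => (l.1, l.2.2))
  exact ⟨M, _, A, B, s, u, v, hA, hB, hM, rfl⟩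

/-! ### The recognized language, the initial loop and the final estimate -/

theorem mem_linearLanguage {n c : ℕ} {w : List (Fin 2 × Fin 2)} :
    w ∈ linearLanguage n c ↔ w.IsChain PairCompat ∧ fibSum 2 (mulDigit n) w = -c := by
  have h1 : w ∈ linearLanguage n c ↔ Valid (w.map Prod.fst) ∧ Valid (w.map Prod.snd) ∧
    n * value (w.map Prod.fst) + c = value (w.map Prod.snd) := Iff.rfl
  rw [h1, isChain_pairCompat, fibSum_mulDigit_value, and_assoc]
  refine and_congr_right fun _ => and_congr_right fun _ => ?_
  zify
  constructor <;> intro h <;> linarith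

theorem zero_cons_mem_linearLanguage {n c : ℕ} {w : List (Fin 2 × Fin 2)} :
    (0, 0) :: w ∈ linearLanguage n c ↔ w ∈ linearLanguage n c := by
  rw [mem_linearLanguage, mem_linearLanguage]
  simp [List.isChain_cons, PairCompat, DigitCompat, fibSum, mulDigit, digit]

/-- A leading zero on both tracks changes neither validity nor values, so the state after `(0, 0)`
has the residual language of the initial state, and minimality identifies them. -/
theorem step_start_eq {M : PDFA (Fin 2 × Fin 2)} {n c : ℕ} (hmin : M.IsMinimal)
    (hL : M.language = linearLanguage n c) : M.step M.start (0, 0) = some M.start := by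
  have hiff : ∀ w, M.AcceptsFrom M.start ([(0, 0)] ++ w) ↔ M.AcceptsFrom M.start w := by
    intro w
    rw [← mem_language, ← mem_language, hL]
    exact zero_cons_mem_linearLanguage
  obtain ⟨w, hw⟩ := (hmin.1 M.start).2
  obtain ⟨p, hp, -⟩ := exists_runFrom_of_acceptsFrom_append ((hiff w).mpr hw)
  have hpq : p = M.start := hmin.2 p M.start fun v => (acceptsFrom_of_runFrom hp v).trans (hiff v)
  rw [hpq] at hp
  simpa [runFrom] using hp

/-- For `n ≥ 2` both 1 and the integral binary logarithm are at most `log n / log 2`, and `2 / log 2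
< 3`. -/
theorem one_add_log_le {n : ℕ} (hn : 1 ≤ n) : (1 + Nat.log 2 n : ℝ) ≤ 3 * logO n := by
  rw [logO]
  split
  · have : n = 1 := by omega
    subst this
    norm_num
  · have h1 := Real.natLog_le_logb n 2
    have h2 : (0.6931471803 : ℝ) < Real.log 2 := Real.log_two_gt_d9
    have h3 : Real.log 2 ≤ Real.log n :=
      Real.log_le_log (by norm_num) (by exact_mod_cast (by omega : 2 ≤ n))
    rw [Real.logb, le_div_iff₀ (by push_cast; linarith)] at h1
    push_cast at h1
    have h4 : (0 : ℝ) ≤ Nat.log 2 n := Nat.cast_nonneg _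
    nlinarith

end Fibonacci

theorem theorem21 :
    ∃ C : ℝ, ∀ n c : ℕ, 1 ≤ n → c < n →
      (∃ M t, Fibonacci.BuildLinear n c M t) ∧
      ∀ (M : PDFA (Fin 2 × Fin 2)) (t : ℕ), Fibonacci.BuildLinear n c M t →
        M.language = Fibonacci.linearLanguage n c ∧
        M.IsMinimal ∧
        M.step M.start (0, 0) = some M.start ∧
        (t : ℝ) ≤ C * ((n : ℝ) ^ 6 * Fibonacci.logO n ^ 2) := by
  -- The 8 covers the number of eliminations, the bracket is the constant of `combineCost`, and `9 =
  -- 3 ^ 2` converts two binary logarithms.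
  refine ⟨8 * (2 ^ 15 * 214 * 4096 * 3) * 9, fun n c hn hc =>
    ⟨Fibonacci.exists_buildLinear hn c, fun M t h => ?_⟩⟩
  obtain ⟨hmin, hL, ht⟩ := h.spec hn hc
  have hL' : M.language = Fibonacci.linearLanguage n c :=
    Set.ext fun w => (hL w).trans Fibonacci.mem_linearLanguage.symm
  refine ⟨hL', hmin, Fibonacci.step_start_eq hmin hL', ?_⟩
  have hlog := Fibonacci.one_add_log_le hn
  calc (t : ℝ) ≤ ((8 * (1 + Nat.log 2 n) * Fibonacci.combineCost n : ℕ) : ℝ) := by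
        exact_mod_cast ht
    _ = 8 * (2 ^ 15 * 214 * 4096 * 3) * ((n : ℝ) ^ 6 * (1 + Nat.log 2 n : ℝ) ^ 2) := by
        rw [Fibonacci.combineCost]
        push_cast
        ring
    _ ≤ 8 * (2 ^ 15 * 214 * 4096 * 3) * ((n : ℝ) ^ 6 * (3 * Fibonacci.logO n) ^ 2) := by
        gcongr
    _ = _ := by ring
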